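/- An instance of Minimum Envy Graphical House Allocation (ME-GHA) consists of an undirected graph $G=(V,E)$ (the social graph) on $n$ agents, a set $H$ of $n$ houses, and for each agent $v\in V$ a valuation $\alpha_v:H\to\mathbb{Q}_{\ge 0}$. The task is to output a bijection $\pi:V\to H$ that minimizes the total envy $$\sum_{\{u,v\}\in E}\Big(\max\{\alpha_u(\pi(v))-\alpha_u(\pi(u)),0\}+\max\{\alpha_v(\pi(u))-\alpha_v(\pi(v)),0\}\Big).$$ For every constant $k$, ME-GHA restricted to instances whose social graph has treewidth at most $k$ can be solved in $\mathcal{O}^\star(4^n)=4^n\cdot n^{\mathcal{O}(1)}$ time, with no restriction on the number of house types (all houses may be distinct). In particular, ME-GHA can be solved in $\mathcal{O}^\star(4^n)$ time when the social graph is a cycle, when it is a path, and when it is a forest. Here time is the number of instructions of a random access machine with addition, subtraction, multiplication and division of natural numbers, which gets the numerators and denominators of the values $\alpha_v(h)$ as numbers; moreover its logarithmic cost (each instruction is charged one plus the bit lengths of its operands and of the addresses it uses) is at most $4^n$ times a polynomial in $n$ and in the largest bit length of a value $\alpha_v(h)$. The machine and the implied constants may depend on $k$. -/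

import Mathlib

open scoped NNRat

namespace MEGHA

/-! ## Tree decompositions and treewidth -/

/-- A tree decomposition of `G`: a finite tree (with at least one node) and a family of bags. -/
structure TreeDecomposition {V : Type*} (G : SimpleGraph V) where
  /-- the number of nodes of the tree -/
  m : ℕ
  /-- the tree -/
  tree : SimpleGraph (Fin m)
  isTree : tree.IsTree
  /-- the bags -/
  bag : Fin m → Finset V
  vertex_mem : ∀ v : V, ∃ t, v ∈ bag t
  edge_mem : ∀ u v : V, G.Adj u v → ∃ t, u ∈ bag t ∧ v ∈ bag t
  connected : ∀ v : V, (tree.induce {t | v ∈ bag t}).Connected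

/-- The width of a tree decomposition: the largest size of a bag, minus one
(and `0` if all bags are empty, which is possible only for the graph without vertices). -/
def TreeDecomposition.width {V : Type*} {G : SimpleGraph V} (D : TreeDecomposition G) : ℕ :=
  (Finset.univ.sup fun t => (D.bag t).card) - 1

/-- The treewidth of a finite graph: the least width of a tree decomposition. -/
noncomputable def treewidth {V : Type*} [Finite V] (G : SimpleGraph V) : ℕ :=
  sInf {w | ∃ D : TreeDecomposition G, D.width = w}

/-! ## Minimum envy graphical house allocation -/

/-- An instance with `n` agents and `n` houses, both numbered `0, …, n - 1`:
a social graph on the agents, and the value `val v h` that agent `v` assigns to house `h`. -/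
structure Instance (n : ℕ) where
  graph : SimpleGraph (Fin n)
  val : Fin n → Fin n → ℚ≥0

namespace Instance

variable {n : ℕ} (I : Instance n)

/-- The envy between agents `v` and `u` that own the houses `hv` and `hu`. -/
def edgeEnvy (v u hv hu : Fin n) : ℚ :=
  max ((I.val v hu : ℚ) - I.val v hv) 0 + max ((I.val u hv : ℚ) - I.val u hu) 0

open Classical in
/-- The total envy of an allocation; each edge of the social graph is counted once. -/
noncomputable def totalEnvy (π : Fin n ≃ Fin n) : ℚ :=
  ∑ u : Fin n, ∑ v : Fin n,
    if u < v ∧ I.graph.Adj u v then I.edgeEnvy u v (π u) (π v) else 0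

/-- The allocation `π` has the least total envy. -/
def IsOptimal (π : Fin n ≃ Fin n) : Prop :=
  ∀ π' : Fin n ≃ Fin n, I.totalEnvy π ≤ I.totalEnvy π'

/-- The largest bit length of a valuation (numerator and denominator in lowest terms). -/
def bitLength : ℕ :=
  Finset.univ.sup fun p : Fin n × Fin n =>
    (I.val p.1 p.2).num.size + (I.val p.1 p.2).den.size

open Classical in
/-- The input as a list of natural numbers: `n`, then the adjacency matrix, the numerators
of the valuations and their denominators, each of the three row by row. -/
noncomputable def encode : List ℕ :=
  n :: ((List.ofFn fun i : Fin (n * n) => if I.graph.Adj i.divNat i.modNat then 1 else 0) ++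
    (List.ofFn fun i : Fin (n * n) => (I.val i.divNat i.modNat).num) ++
    (List.ofFn fun i : Fin (n * n) => (I.val i.divNat i.modNat).den))

end Instance

/-! ## Random access machines -/

/-- The instructions of a random access machine with registers `R 0, R 1, …` and memory
cells `M 0, M 1, …`, all of which hold natural numbers. -/
inductive Instr where
  /-- `R r := c` -/
  | const (r c : ℕ)
  /-- `R r := R s + R t` -/
  | add (r s t : ℕ)
  /-- `R r := R s - R t`, truncated at `0` -/
  | sub (r s t : ℕ)
  /-- `R r := R s * R t` -/
  | mul (r s t : ℕ)
  /-- `R r := R s / R t`, rounded down, and `0` if `R t = 0` -/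
  | div (r s t : ℕ)
  /-- `R r := M (R s)` -/
  | load (r s : ℕ)
  /-- `M (R r) := R s` -/
  | store (r s : ℕ)
  /-- go to instruction `l` -/
  | jump (l : ℕ)
  /-- go to instruction `l` if `R r < R s` -/
  | jumpLt (r s l : ℕ)

/-- A program is a finite list of instructions. -/
abbrev Program : Type := List Instr

/-- A configuration: the number of the next instruction, the registers and the memory. -/
structure Config where
  pc : ℕ
  reg : ℕ → ℕ
  mem : ℕ → ℕ

/-- The effect of one instruction. -/
def Instr.exec (c : Config) : Instr → Config
  | const r a => { c with pc := c.pc + 1, reg := Function.update c.reg r a }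
  | add r s t => { c with pc := c.pc + 1, reg := Function.update c.reg r (c.reg s + c.reg t) }
  | sub r s t => { c with pc := c.pc + 1, reg := Function.update c.reg r (c.reg s - c.reg t) }
  | mul r s t => { c with pc := c.pc + 1, reg := Function.update c.reg r (c.reg s * c.reg t) }
  | div r s t => { c with pc := c.pc + 1, reg := Function.update c.reg r (c.reg s / c.reg t) }
  | load r s => { c with pc := c.pc + 1, reg := Function.update c.reg r (c.mem (c.reg s)) }
  | store r s => { c with pc := c.pc + 1, mem := Function.update c.mem (c.reg r) (c.reg s) }
  | jump l => { c with pc := l }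
  | jumpLt r s l => { c with pc := if c.reg r < c.reg s then l else c.pc + 1 }

/-- The logarithmic cost of one instruction: one plus the bit lengths of its operands,
including the addresses of the memory cells that it uses. -/
def Instr.logCost (c : Config) : Instr → ℕ
  | const _ a => 1 + a.size
  | add _ s t => 1 + (c.reg s).size + (c.reg t).size
  | sub _ s t => 1 + (c.reg s).size + (c.reg t).size
  | mul _ s t => 1 + (c.reg s).size + (c.reg t).size
  | div _ s t => 1 + (c.reg s).size + (c.reg t).size
  | load _ s => 1 + (c.reg s).size + (c.mem (c.reg s)).size
  | store r s => 1 + (c.reg r).size + (c.reg s).size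
  | jump _ => 1
  | jumpLt r s _ => 1 + (c.reg r).size + (c.reg s).size

namespace Program

/-- One step. The machine has halted when there is no instruction with number `c.pc`. -/
def step (P : Program) (c : Config) : Config :=
  match P[c.pc]? with
  | some i => i.exec c
  | none => c

/-- The logarithmic cost of one step. -/
def stepCost (P : Program) (c : Config) : ℕ :=
  match P[c.pc]? with
  | some i => i.logCost c
  | none => 0

/-- The configuration after `t` steps. -/
def run (P : Program) (t : ℕ) (c : Config) : Config := P.step^[t] c

/-- The machine has halted. -/
def Halted (P : Program) (c : Config) : Prop := P.length ≤ c.pc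

/-- The logarithmic cost of the first `t` steps. -/
def logCost (P : Program) (t : ℕ) (c : Config) : ℕ :=
  ∑ i ∈ Finset.range t, P.stepCost (P.run i c)

/-- The initial configuration on a list: the list is written in the first memory cells,
all other cells and all registers hold `0`. -/
def init (x : List ℕ) : Config where
  pc := 0
  reg := fun _ => 0
  mem := fun a => x.getD a 0

/-- On the instance `I` the program halts after at most `t` steps, of logarithmic cost at most
`b` in total, and the memory then holds an allocation of least total envy:
cell `v` contains the house of agent `v`. -/
def Solves (P : Program) {n : ℕ} (I : Instance n) (t b : ℕ) : Prop :=
  ∃ s ≤ t, P.Halted (P.run s (init I.encode)) ∧ P.logCost s (init I.encode) ≤ b ∧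
    ∃ π : Fin n ≃ Fin n, I.IsOptimal π ∧
      ∀ v : Fin n, (P.run s (init I.encode)).mem v = (π v : ℕ)

end Program

/-- A class of (numbered) finite graphs. -/
abbrev GraphClass : Type := (n : ℕ) → SimpleGraph (Fin n) → Prop

/-- On instances whose social graph belongs to `𝒢`, the problem can be solved in time `O*(T n)`
where `n` is the number of agents: one program solves all of them with at most
`T n * n ^ O(1)` instructions; moreover the logarithmic cost is at most `T n` times a polynomial
in `n` and in the bit length of the valuations. -/
def SolvableInOStar (𝒢 : GraphClass) (T : ℕ → ℕ) : Prop :=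
  ∃ (P : Program) (C c : ℕ), ∀ (n : ℕ) (I : Instance n), 𝒢 n I.graph →
    P.Solves I (C * T n * (n + 1) ^ c) (C * T n * (n + 1) ^ c * (I.bitLength + 1) ^ c)

/-- The graphs of treewidth at most `k`. -/
def treewidthAtMost (k : ℕ) : GraphClass := fun _ G => treewidth G ≤ k

/-- The cycles: graphs isomorphic to the cycle on `n ≥ 3` vertices. -/
def cycles : GraphClass := fun n G => 3 ≤ n ∧ Nonempty (G ≃g SimpleGraph.cycleGraph n)

/-- The paths: graphs isomorphic to the path on `n` vertices. -/
def paths : GraphClass := fun n G => Nonempty (G ≃g SimpleGraph.pathGraph n)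

/-- The forests. -/
def forests : GraphClass := fun _ G => G.IsAcyclic

end MEGHA

/-!
One program solves all instances, and only the analysis of its running time depends on the graph.
Let the *boundary* of a set of agents consist of its members with a neighbour outside of the set.
If the agents receive their houses one after the other, in the order `O`, then all that the later
decisions need to know about a partial allocation is the set of houses in use and the houses of the
agents on the boundary of the initial segment of `O` that has been served. Among the partial
allocations that agree in these data, called their *signature*, only one of least envy has to be
kept (`dominance_allocCost`). If the boundaries of all initial segments of `O` have at most `w`
members, there are at most `2 ^ n * (n + 1) ^ w` signatures.

An order `O` with small boundaries is found by a dynamic program of the same kind over the sets of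
agents (`dominance_widthCost`), in time `2 ^ n` up to a polynomial factor. It minimizes the sum of
the powers `(n + 1) ^ b` over the sizes `b` of the boundaries, which bounds the number of signatures
per set of houses. Both searches are instances of one command, `Search.cmd`, with the correctness
proof `Search.exec_cmd`.

For a graph of treewidth at most `k`, some bag of a tree decomposition separates any given set of
vertices into parts with at most half of its elements (`exists_centroid`). Listing first the bag and
then the parts, recursively, gives an order with boundaries of size at most
`(k + 1) * (log₂ n + 1)` (`HasSeparators.hasVertexOrder`). A forest is separated by single
vertices in the same way. For paths and cycles the natural order has boundaries of size at most
two. In all cases `(n + 1) ^ w` is at most a constant times `2 ^ n` (`exists_pow_log_le`), so that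
the total time is `2 ^ n * 2 ^ n` up to a polynomial factor.

The machine program is obtained by compiling a command of a small imperative language whose
expressions are built from arithmetic, memory access, and sums and products over `0, …, n - 1`.
Every expression takes polynomially many steps and has values of polynomial bit length
(`Expr.polyBounded_time`, `Expr.polyBounded_bits`), so that only the number of iterations of the
loops over the tables, and the bit lengths of the stored values, have to be estimated by hand.
Rational valuations are replaced by natural numbers, by multiplication with the product of all
denominators.
-/

namespace MEGHA

open Function

/-! ### Polynomially bounded functions -/

/-- `g n L` is bounded by a polynomial in `n + L`. -/
def PolyBounded (g : ℕ → ℕ → ℕ) : Prop :=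
  ∃ C c : ℕ, ∀ n L, g n L ≤ C * (n + L + 1) ^ c

namespace PolyBounded

variable {f g : ℕ → ℕ → ℕ}

theorem const (a : ℕ) : PolyBounded fun _ _ => a := ⟨a, 0, by simp⟩

theorem fst : PolyBounded fun n _ => n := ⟨1, 1, fun n L => by simp; omega⟩

theorem snd : PolyBounded fun _ L => L := ⟨1, 1, fun n L => by simp; omega⟩

theorem add (hf : PolyBounded f) (hg : PolyBounded g) :
    PolyBounded fun n L => f n L + g n L := by
  obtain ⟨C, c, hC⟩ := hf
  obtain ⟨D, d, hD⟩ := hg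
  refine ⟨C + D, c + d, fun n L => ?_⟩
  have h1 : (n + L + 1) ^ c ≤ (n + L + 1) ^ (c + d) := Nat.pow_le_pow_right (by omega) (by omega)
  have h2 : (n + L + 1) ^ d ≤ (n + L + 1) ^ (c + d) := Nat.pow_le_pow_right (by omega) (by omega)
  calc f n L + g n L ≤ C * (n + L + 1) ^ c + D * (n + L + 1) ^ d := add_le_add (hC n L) (hD n L)
    _ ≤ C * (n + L + 1) ^ (c + d) + D * (n + L + 1) ^ (c + d) := by gcongr
    _ = _ := by ring

theorem mul (hf : PolyBounded f) (hg : PolyBounded g) :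
    PolyBounded fun n L => f n L * g n L := by
  obtain ⟨C, c, hC⟩ := hf
  obtain ⟨D, d, hD⟩ := hg
  refine ⟨C * D, c + d, fun n L => ?_⟩
  calc f n L * g n L ≤ C * (n + L + 1) ^ c * (D * (n + L + 1) ^ d) :=
        Nat.mul_le_mul (hC n L) (hD n L)
    _ = _ := by ring

theorem comp (hf : PolyBounded f) (hg : PolyBounded g) :
    PolyBounded fun n L => f n (g n L) := by
  obtain ⟨C, c, hC⟩ := hf
  obtain ⟨D, d, hD⟩ := hg
  refine ⟨C * (D + 1) ^ c, (d + 1) * c, fun n L => ?_⟩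
  have h1 : n + g n L + 1 ≤ (D + 1) * (n + L + 1) ^ (d + 1) := by
    have h2 : (n + L + 1) ^ d ≤ (n + L + 1) ^ (d + 1) :=
      Nat.pow_le_pow_right (by omega) (by omega)
    have h3 : n + L + 1 ≤ (n + L + 1) ^ (d + 1) := Nat.le_self_pow (by omega) _
    have h4 := hD n L
    have h5 : D * (n + L + 1) ^ d ≤ D * (n + L + 1) ^ (d + 1) := Nat.mul_le_mul_left _ h2
    rw [add_mul, one_mul]
    omega
  calc f n (g n L) ≤ C * (n + g n L + 1) ^ c := hC _ _
    _ ≤ C * ((D + 1) * (n + L + 1) ^ (d + 1)) ^ c := by gcongr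
    _ = _ := by rw [mul_pow, ← pow_mul]; ring

end PolyBounded

/-! ### A language of arithmetic expressions -/

/-- The arithmetic operations of the machine. -/
inductive Op where
  | add | sub | mul | div

/-- The value of an arithmetic operation. -/
def Op.eval : Op → ℕ → ℕ → ℕ
  | add, a, b => a + b
  | sub, a, b => a - b
  | mul, a, b => a * b
  | div, a, b => a / b

/-- The machine instruction `R r := R s op R t`. -/
def Op.instr : Op → ℕ → ℕ → ℕ → Instr
  | add => .add
  | sub => .sub
  | mul => .mul
  | div => .div

/-- Arithmetic expressions over variables named by natural numbers, which may read the memory.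
All loops inside an expression are sums or products over the range `0, …, n - 1`, where `n` is
the size parameter; this is what makes running time and bit lengths of every expression
polynomially bounded. -/
inductive Expr where
  | const (c : ℕ)
  /-- the size parameter `n` -/
  | size
  | var (x : ℕ)
  | op (f : Op) (a b : Expr)
  | load (a : Expr)
  /-- the value of `b` where `x` stands for the value of `a` -/
  | letE (x : ℕ) (a b : Expr)
  /-- the product (for `true`) or the sum (for `false`) of `b` over `x < n` -/
  | fold (p : Bool) (x : ℕ) (b : Expr)

/-- The product (for `true`) or the sum (for `false`) of `g i` over `i < n`. -/
def bigOp (p : Bool) (n : ℕ) (g : ℕ → ℕ) : ℕ :=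
  if p then ∏ i ∈ Finset.range n, g i else ∑ i ∈ Finset.range n, g i

/-- The neutral element of the operation that `bigOp p` iterates. -/
def bigUnit (p : Bool) : ℕ := if p then 1 else 0

/-- The operation that `bigOp p` iterates. -/
def bigStep (p : Bool) : Op := if p then .mul else .add

theorem bigOp_zero (p : Bool) (g : ℕ → ℕ) : bigOp p 0 g = bigUnit p := by
  cases p <;> simp [bigOp, bigUnit]

theorem bigOp_succ (p : Bool) (n : ℕ) (g : ℕ → ℕ) :
    bigOp p (n + 1) g = (bigStep p).eval (bigOp p n g) (g n) := by
  cases p <;> simp [bigOp, bigStep, Op.eval, Finset.sum_range_succ, Finset.prod_range_succ]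

theorem Op.eval_lt {a b x y : ℕ} (f : Op) (ha : a < 2 ^ x) (hb : b < 2 ^ y) :
    f.eval a b < 2 ^ (x + y + 1) := by
  have hx : 0 < 2 ^ x := by positivity
  have hy : 0 < 2 ^ y := by positivity
  have h1 : 2 ^ x ≤ 2 ^ x * 2 ^ y := Nat.le_mul_of_pos_right _ hy
  have h2 : 2 ^ y ≤ 2 ^ x * 2 ^ y := Nat.le_mul_of_pos_left _ hx
  rw [pow_succ, pow_add]
  cases f with
  | add => simp only [Op.eval]; omega
  | sub => simp only [Op.eval]; omega
  | mul =>
    have := Nat.mul_lt_mul'' ha hb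
    simp only [Op.eval]; omega
  | div =>
    have := Nat.div_le_self a b
    simp only [Op.eval]; omega

namespace Expr

/-- The value of an expression, for the size parameter `n`, the values `env` of the variables,
and the memory `mem`. -/
def eval (n : ℕ) : Expr → (ℕ → ℕ) → (ℕ → ℕ) → ℕ
  | const c, _, _ => c
  | size, _, _ => n
  | var x, env, _ => env x
  | op f a b, env, mem => f.eval (a.eval n env mem) (b.eval n env mem)
  | load a, env, mem => mem (a.eval n env mem)
  | letE x a b, env, mem => b.eval n (Function.update env x (a.eval n env mem)) mem
  | fold p x b, env, mem => bigOp p n fun i => b.eval n (Function.update env x i) mem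

/-- The number of steps that the compiled expression takes. -/
def time (n : ℕ) : Expr → ℕ
  | const _ => 1
  | size => 2
  | var _ => 2
  | op _ a b => a.time n + b.time n + 1
  | load a => a.time n + 1
  | letE _ a b => a.time n + b.time n + 2
  | fold _ _ b => 4 + n * (b.time n + 5)

/-- If the size parameter, the variables and the memory cells have at most `L` bits, then
`bits n L e` bounds the bit length of the value of `e` and the logarithmic cost of every step
of its evaluation. -/
def bits (n : ℕ) : ℕ → Expr → ℕ
  | _, const c => c + 1
  | L, size => L + 1
  | L, var _ => L + 1
  | L, op _ a b => a.bits n L + b.bits n L + 1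
  | L, load a => a.bits n L + L + 1
  | L, letE _ a b => a.bits n L + b.bits n (L + a.bits n L) + 2
  | L, fold _ _ b => (n + 1) * (b.bits n L + 1) + b.bits n L + 2 * L + 3

theorem polyBounded_time (e : Expr) : PolyBounded fun n _ => e.time n := by
  induction e with
  | const c => exact .const 1
  | size => exact .const 2
  | var x => exact .const 2
  | op f a b ha hb => exact (ha.add hb).add (.const 1)
  | load a ha => exact ha.add (.const 1)
  | letE x a b ha hb => exact (ha.add hb).add (.const 2)
  | fold p x b hb => exact (PolyBounded.const 4).add (PolyBounded.fst.mul (hb.add (.const 5)))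

theorem polyBounded_bits (e : Expr) : PolyBounded fun n L => e.bits n L := by
  induction e with
  | const c => exact .const (c + 1)
  | size => exact PolyBounded.snd.add (.const 1)
  | var x => exact PolyBounded.snd.add (.const 1)
  | op f a b ha hb => exact (ha.add hb).add (.const 1)
  | load a ha => exact (ha.add .snd).add (.const 1)
  | letE x a b ha hb => exact (ha.add (hb.comp (PolyBounded.snd.add ha))).add (.const 2)
  | fold p x b hb =>
    exact ((((PolyBounded.fst.add (.const 1)).mul (hb.add (.const 1))).add hb).add
      ((PolyBounded.const 2).mul .snd)).add (.const 3)

end Expr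

theorem bigOp_lt (p : Bool) (n k : ℕ) {g : ℕ → ℕ} (hg : ∀ i < n, g i < 2 ^ k) :
    bigOp p n g < 2 ^ (n * (k + 1) + 1) := by
  induction n with
  | zero => cases p <;> simp [bigOp]
  | succ n ih =>
    rw [bigOp_succ]
    have := (bigStep p).eval_lt (ih fun i hi => hg i (by omega)) (hg n (by omega))
    convert this using 2
    ring

theorem update_lt {env : ℕ → ℕ} {b v : ℕ} (henv : ∀ x, env x < b) (x : ℕ) (hv : v < b) (y : ℕ) :
    Function.update env x v y < b := by
  by_cases h : y = x
  · simpa [h] using hv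
  · simpa [h] using henv y

/-- The value of an expression has at most `Expr.bits` bits. -/
theorem Expr.eval_lt {n : ℕ} (e : Expr) : ∀ {L : ℕ} {env mem : ℕ → ℕ}, n < 2 ^ L →
    (∀ x, env x < 2 ^ L) → (∀ a, mem a < 2 ^ L) → e.eval n env mem < 2 ^ e.bits n L := by
  induction e with
  | const c =>
    exact fun _ _ _ => (Nat.lt_two_pow_self (n := c)).trans
      (Nat.pow_lt_pow_right (by omega) (by simp [bits]))
  | size => exact fun hn _ _ => hn.trans (Nat.pow_lt_pow_right (by omega) (by simp [bits]))
  | var x => exact fun _ he _ => (he x).trans (Nat.pow_lt_pow_right (by omega) (by simp [bits]))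
  | op f a b ha hb => exact fun hn he hm => f.eval_lt (ha hn he hm) (hb hn he hm)
  | load a ha =>
    exact fun _ _ hm => (hm _).trans (Nat.pow_lt_pow_right (by omega) (by simp only [bits]; omega))
  | letE x a b ha hb =>
    intro L env mem hn he hm
    have hL : 2 ^ L ≤ 2 ^ (L + a.bits n L) := Nat.pow_le_pow_right (by omega) (by omega)
    have hL' : 2 ^ a.bits n L ≤ 2 ^ (L + a.bits n L) := Nat.pow_le_pow_right (by omega) (by omega)
    refine (hb (hn.trans_le hL) (update_lt (fun x => (he x).trans_le hL) x
      ((ha hn he hm).trans_le hL')) fun a => (hm a).trans_le hL).trans_le ?_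
    exact Nat.pow_le_pow_right (by omega) (by simp only [bits]; omega)
  | fold p x b hb =>
    intro L env mem hn he hm
    refine (bigOp_lt p n (b.bits n L) fun i hi => ?_).trans_le ?_
    · exact hb hn (update_lt he x (hi.trans hn)) hm
    · refine Nat.pow_le_pow_right (by omega) ?_
      simp only [bits]
      nlinarith

/-! ### Runs of the machine -/

/-- The program takes `τ` steps from `c` to `c'`, each of logarithmic cost at most `K`. -/
def Steps (P : Program) (K τ : ℕ) (c c' : Config) : Prop :=
  P.run τ c = c' ∧ ∀ i < τ, P.stepCost (P.run i c) ≤ K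

namespace Steps

variable {P : Program} {K K' τ τ' : ℕ} {c c' c'' : Config}

theorem mono (h : Steps P K τ c c') (hK : K ≤ K') : Steps P K' τ c c' :=
  ⟨h.1, fun i hi => (h.2 i hi).trans hK⟩

theorem trans (h : Steps P K τ c c') (h' : Steps P K τ' c' c'') :
    Steps P K (τ + τ') c c'' := by
  have key : ∀ i, P.run (τ + i) c = P.run i c' := by
    intro i
    rw [← h.1, Program.run, Program.run, Program.run, add_comm, Function.iterate_add_apply]
  refine ⟨by rw [key, h'.1], fun i hi => ?_⟩
  by_cases hτ : i < τ
  · exact h.2 i hτ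
  · obtain ⟨j, rfl⟩ := Nat.exists_eq_add_of_le (not_lt.1 hτ)
    rw [key]
    exact h'.2 j (by omega)

theorem single {i : Instr} (h : P[c.pc]? = some i) (hK : i.logCost c ≤ K) (hc : i.exec c = c') :
    Steps P K 1 c c' := by
  refine ⟨by simp [Program.run, Program.step, h, hc], fun j hj => ?_⟩
  obtain rfl : j = 0 := by omega
  simpa [Program.run, Program.stepCost, h] using hK

end Steps

/-- The instructions `l` stand in the program `P` from position `o` on. -/
def CodeAt (P : Program) (o : ℕ) (l : List Instr) : Prop :=
  ∀ i (h : i < l.length), P[o + i]? = some l[i]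

theorem codeAt_append {P : Program} {o : ℕ} {l l' : List Instr} :
    CodeAt P o (l ++ l') ↔ CodeAt P o l ∧ CodeAt P (o + l.length) l' := by
  refine ⟨fun h => ⟨fun i hi => ?_, fun i hi => ?_⟩, fun h i hi => ?_⟩
  · rw [h i (by simp; omega), List.getElem_append_left hi]
  · have := h (l.length + i) (by simp; omega)
    rw [← add_assoc] at this
    rw [this, List.getElem_append_right (by omega)]
    simp
  · by_cases hl : i < l.length
    · rw [h.1 i hl, List.getElem_append_left hl]
    · obtain ⟨j, rfl⟩ := Nat.exists_eq_add_of_le (not_lt.1 hl)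
      rw [← add_assoc, h.2 j (by simp at hi; omega), List.getElem_append_right (by omega)]
      simp

theorem codeAt_cons {P : Program} {o : ℕ} {i : Instr} {l : List Instr} :
    CodeAt P o (i :: l) ↔ P[o]? = some i ∧ CodeAt P (o + 1) l := by
  rw [← List.singleton_append, codeAt_append]
  refine and_congr ⟨fun h => h 0 (by simp), fun h j hj => ?_⟩ Iff.rfl
  obtain rfl : j = 0 := by simpa using hj
  simpa using h

theorem size_le_of_lt {a L : ℕ} (h : a < 2 ^ L) : a.size ≤ L := Nat.size_le.2 h

/-! ### Compiling expressions -/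

/-- The number of instructions of the compiled expression. -/
def Expr.len : Expr → ℕ
  | const _ => 1
  | size => 2
  | var _ => 2
  | op _ a b => a.len + b.len + 1
  | load a => a.len + 1
  | letE _ a b => a.len + b.len + 2
  | fold _ _ b => b.len + 8

/-- Code that stands at position `o` and writes the value of the expression into register `t`.
The variable `x` is kept in register `ρ x`, the size parameter in register `0`; the registers
from `t` on are scratch space. -/
def Expr.compile : Expr → (ρ : ℕ → ℕ) → (t o : ℕ) → List Instr
  | const c, _, t, _ => [.const t c]
  | size, _, t, _ => [.const t 0, .add t 0 t]
  | var x, ρ, t, _ => [.const t 0, .add t (ρ x) t]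
  | op f a b, ρ, t, o =>
    a.compile ρ t o ++ (b.compile ρ (t + 1) (o + a.len) ++ [f.instr t t (t + 1)])
  | load a, ρ, t, o => a.compile ρ t o ++ [.load t t]
  | letE x a b, ρ, t, o =>
    a.compile ρ t o ++ (b.compile (update ρ x t) (t + 1) (o + a.len) ++
      [.const t 0, .add t (t + 1) t])
  | fold p x b, ρ, t, o =>
    [.const t (bigUnit p), .const (t + 1) 0, .jumpLt (t + 1) 0 (o + 4), .jump (o + b.len + 8)] ++
      (b.compile (update ρ x (t + 1)) (t + 2) (o + 4) ++
        [(bigStep p).instr t t (t + 2), .const (t + 2) 1, .add (t + 1) (t + 1) (t + 2),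
          .jump (o + 2)])

theorem Expr.length_compile (e : Expr) : ∀ ρ t o, (e.compile ρ t o).length = e.len := by
  induction e with
  | const c => simp [compile, len]
  | size => simp [compile, len]
  | var x => simp [compile, len]
  | op f a b ha hb => intros; simp [compile, len, ha, hb, add_assoc]
  | load a ha => simp [compile, len, ha]
  | letE x a b ha hb => intros; simp [compile, len, ha, hb, add_assoc]
  | fold p x b hb => intros; simp [compile, len, hb]

theorem Op.exec_instr (f : Op) (c : Config) (r s t : ℕ) :
    (f.instr r s t).exec c =
      { c with pc := c.pc + 1, reg := update c.reg r (f.eval (c.reg s) (c.reg t)) } := by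
  cases f <;> rfl

theorem Op.logCost_instr (f : Op) (c : Config) (r s t : ℕ) :
    (f.instr r s t).logCost c = 1 + (c.reg s).size + (c.reg t).size := by
  cases f <;> rfl

namespace Steps

variable {P : Program} {K o r s t : ℕ} {reg mem : ℕ → ℕ}

theorem const {a : ℕ} (h : P[o]? = some (.const r a)) (hK : 1 + a.size ≤ K) :
    Steps P K 1 ⟨o, reg, mem⟩ ⟨o + 1, update reg r a, mem⟩ :=
  .single h hK rfl

theorem op {f : Op} (h : P[o]? = some (f.instr r s t))
    (hK : 1 + (reg s).size + (reg t).size ≤ K) :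
    Steps P K 1 ⟨o, reg, mem⟩ ⟨o + 1, update reg r (f.eval (reg s) (reg t)), mem⟩ :=
  .single h (by rwa [f.logCost_instr]) (f.exec_instr _ _ _ _)

theorem load (h : P[o]? = some (.load r s)) (hK : 1 + (reg s).size + (mem (reg s)).size ≤ K) :
    Steps P K 1 ⟨o, reg, mem⟩ ⟨o + 1, update reg r (mem (reg s)), mem⟩ :=
  .single h hK rfl

theorem store (h : P[o]? = some (.store r s)) (hK : 1 + (reg r).size + (reg s).size ≤ K) :
    Steps P K 1 ⟨o, reg, mem⟩ ⟨o + 1, reg, update mem (reg r) (reg s)⟩ :=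
  .single h hK rfl

theorem jump {l : ℕ} (h : P[o]? = some (.jump l)) (hK : 1 ≤ K) :
    Steps P K 1 ⟨o, reg, mem⟩ ⟨l, reg, mem⟩ :=
  .single h hK rfl

theorem jumpLt_of_lt {l : ℕ} (h : P[o]? = some (.jumpLt r s l))
    (hK : 1 + (reg r).size + (reg s).size ≤ K) (hlt : reg r < reg s) :
    Steps P K 1 ⟨o, reg, mem⟩ ⟨l, reg, mem⟩ :=
  .single h hK (by simp [Instr.exec, hlt])

theorem jumpLt_of_not_lt {l : ℕ} (h : P[o]? = some (.jumpLt r s l))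
    (hK : 1 + (reg r).size + (reg s).size ≤ K) (hlt : ¬ reg r < reg s) :
    Steps P K 1 ⟨o, reg, mem⟩ ⟨o + 1, reg, mem⟩ :=
  .single h hK (by simp [Instr.exec, hlt])

/-- Copying the register `s` to the register `t`. -/
theorem move (h : P[o]? = some (.const t 0)) (h' : P[o + 1]? = some (.add t s t)) (hst : s ≠ t)
    (hK : 1 + (reg s).size ≤ K) :
    Steps P K 2 ⟨o, reg, mem⟩ ⟨o + 2, update reg t (reg s), mem⟩ := by
  have h1 : Steps P K 1 ⟨o, reg, mem⟩ _ := .const h (by simp; omega)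
  have h2 := h1.trans (.op (f := .add) h' (by simp [hst]; omega))
  simpa [Op.eval, hst, add_assoc] using h2

/-- Adding one to the register `r`, where `s` is a scratch register. -/
theorem incr (h : P[o]? = some (.const s 1)) (h' : P[o + 1]? = some (.add r r s)) (hrs : r ≠ s)
    (hK : 2 + (reg r).size ≤ K) :
    Steps P K 2 ⟨o, reg, mem⟩ ⟨o + 2, update (update reg s 1) r (reg r + 1), mem⟩ := by
  have h1 : Steps P K 1 ⟨o, reg, mem⟩ _ := .const h (by simp; omega)
  have h2 := h1.trans (.op (f := .add) h' (by simp [hrs]; omega))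
  simpa [Op.eval, hrs, add_assoc] using h2

end Steps

theorem comp_update_of_lt {ρ reg reg' : ℕ → ℕ} {t : ℕ} (hρ : ∀ x, ρ x < t)
    (h : ∀ r < t, reg' r = reg r) (x : ℕ) {s : ℕ} :
    reg' ∘ update ρ x s = update (reg ∘ ρ) x (reg' s) := by
  funext y
  by_cases hy : y = x
  · subst hy; simp
  · simp [hy, h _ (hρ y)]

theorem update_lt_succ {ρ : ℕ → ℕ} {t s : ℕ} (hρ : ∀ x, ρ x < t) (x : ℕ) (h : t ≤ s) (y : ℕ) :
    update ρ x s y < s + 1 :=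
  update_lt (fun y => (hρ y).trans_le (by omega)) x (by omega) y

/-- The compiled expression computes the value of the expression, in the time and with the cost
announced by `Expr.time` and `Expr.bits`. -/
theorem Expr.steps_compile {P : Program} {n : ℕ} {mem : ℕ → ℕ} (e : Expr) :
    ∀ {L t o : ℕ} {ρ reg : ℕ → ℕ}, CodeAt P o (e.compile ρ t o) → 1 ≤ t → (∀ x, ρ x < t) →
      reg 0 = n → n < 2 ^ L → (∀ x, reg (ρ x) < 2 ^ L) → (∀ a, mem a < 2 ^ L) →
      ∃ reg', Steps P (e.bits n L) (e.time n) ⟨o, reg, mem⟩ ⟨o + e.len, reg', mem⟩ ∧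
        reg' t = e.eval n (reg ∘ ρ) mem ∧ ∀ r < t, reg' r = reg r := by
  induction e with
  | const c =>
    intro L t o ρ reg hP ht hρ h0 hn he hm
    simp only [compile, codeAt_cons] at hP
    refine ⟨update reg t c, .const hP.1 ?_, by simp [eval], fun r hr => by simp [hr.ne]⟩
    have := size_le_of_lt (Nat.lt_two_pow_self (n := c))
    simp only [bits]; omega
  | size =>
    intro L t o ρ reg hP ht hρ h0 hn he hm
    simp only [compile, codeAt_cons] at hP
    refine ⟨update reg t (reg 0), .move hP.1 hP.2.1 (by omega) ?_, by simp [eval, h0],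
      fun r hr => by simp [hr.ne]⟩
    have := size_le_of_lt hn
    simp only [h0, bits]; omega
  | var x =>
    intro L t o ρ reg hP ht hρ h0 hn he hm
    simp only [compile, codeAt_cons] at hP
    refine ⟨update reg t (reg (ρ x)), .move hP.1 hP.2.1 (hρ x).ne ?_, by simp [eval],
      fun r hr => by simp [hr.ne]⟩
    have := size_le_of_lt (he x)
    simp only [bits]; omega
  | op f a b ha hb =>
    intro L t o ρ reg hP ht hρ h0 hn he hm
    simp only [compile, codeAt_append, length_compile, codeAt_cons] at hP
    obtain ⟨r1, s1, v1, f1⟩ := ha hP.1 ht hρ h0 hn he hm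
    have hcomp : r1 ∘ ρ = reg ∘ ρ := funext fun x => f1 _ (hρ x)
    obtain ⟨r2, s2, v2, f2⟩ := hb (reg := r1) hP.2.1 (by omega) (fun x => (hρ x).trans (by omega))
      (by rw [f1 _ (by omega), h0]) hn (fun x => by rw [f1 _ (hρ x)]; exact he x) hm
    rw [hcomp] at v2
    have h1 := size_le_of_lt (a.eval_lt (env := reg ∘ ρ) hn he hm)
    have h2 := size_le_of_lt (b.eval_lt (env := reg ∘ ρ) hn he hm)
    have e1 : r2 t = a.eval n (reg ∘ ρ) mem := by rw [f2 _ (by omega), v1]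
    rw [← e1] at h1
    rw [← v2] at h2
    refine ⟨update r2 t (f.eval (r2 t) (r2 (t + 1))), ?_, ?_, ?_⟩
    · have q1 := s1.mono (K' := (op f a b).bits n L) (by simp only [bits]; omega)
      have q2 := s2.mono (K' := (op f a b).bits n L) (by simp only [bits]; omega)
      have q3 := (q1.trans q2).trans (.op hP.2.2.1 (by simp only [bits]; omega))
      simpa only [len, time, add_assoc] using q3
    · rw [update_self, v2, e1]; rfl
    · intro r hr
      rw [update_of_ne hr.ne, f2 _ (by omega), f1 _ hr]
  | load a ha =>
    intro L t o ρ reg hP ht hρ h0 hn he hm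
    simp only [compile, codeAt_append, length_compile, codeAt_cons] at hP
    obtain ⟨r1, s1, v1, f1⟩ := ha hP.1 ht hρ h0 hn he hm
    have h1 := size_le_of_lt (a.eval_lt (env := reg ∘ ρ) hn he hm)
    have h2 := size_le_of_lt (hm (r1 t))
    rw [← v1] at h1
    refine ⟨update r1 t (mem (r1 t)), ?_, ?_, ?_⟩
    · have q1 := s1.mono (K' := (load a).bits n L) (by simp only [bits]; omega)
      have q2 := q1.trans (.load hP.2.1 (by simp only [bits]; omega))
      simpa only [len, time, add_assoc] using q2
    · rw [update_self, v1]; rfl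
    · intro r hr
      rw [update_of_ne hr.ne, f1 _ hr]
  | letE x a b ha hb =>
    intro L t o ρ reg hP ht hρ h0 hn he hm
    simp only [compile, codeAt_append, length_compile, codeAt_cons] at hP
    obtain ⟨r1, s1, v1, f1⟩ := ha hP.1 ht hρ h0 hn he hm
    have hva := a.eval_lt (env := reg ∘ ρ) hn he hm
    have hL : 2 ^ L ≤ 2 ^ (L + a.bits n L) := Nat.pow_le_pow_right (by omega) (by omega)
    have hL' : 2 ^ a.bits n L ≤ 2 ^ (L + a.bits n L) := Nat.pow_le_pow_right (by omega) (by omega)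
    have hcomp := comp_update_of_lt hρ f1 x (s := t)
    rw [v1] at hcomp
    have hne : ∀ y, update (reg ∘ ρ) x (a.eval n (reg ∘ ρ) mem) y < 2 ^ (L + a.bits n L) :=
      update_lt (fun y => (he y).trans_le hL) x (hva.trans_le hL')
    obtain ⟨r2, s2, v2, f2⟩ := hb (reg := r1) (L := L + a.bits n L) hP.2.1 (by omega)
      (update_lt_succ hρ x le_rfl) (by rw [f1 _ (by omega), h0]) (hn.trans_le hL)
      (fun y => by rw [← comp_apply (f := r1), hcomp]; exact hne y) (fun y => (hm y).trans_le hL)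
    rw [hcomp] at v2
    have hvb := size_le_of_lt (b.eval_lt (hn.trans_le hL) hne (fun y => (hm y).trans_le hL))
    rw [← v2] at hvb
    refine ⟨update r2 t (r2 (t + 1)), ?_, ?_, ?_⟩
    · have q1 := s1.mono (K' := (letE x a b).bits n L) (by simp only [bits]; omega)
      have q2 := s2.mono (K' := (letE x a b).bits n L) (by simp only [bits]; omega)
      have q3 := (q1.trans q2).trans (.move hP.2.2.1 hP.2.2.2.1 (by omega)
        (by simp only [bits]; omega))
      simpa only [len, time, add_assoc] using q3
    · rw [update_self, v2]; rfl
    · intro r hr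
      rw [update_of_ne hr.ne, f2 _ (by omega), f1 _ hr]
  | fold p x b hb =>
    intro L t o ρ reg hP ht hρ h0 hn he hm
    simp only [compile, codeAt_append, length_compile, codeAt_cons, List.length_cons,
      List.length_nil] at hP
    obtain ⟨⟨p0, p1, p2, p3, -⟩, pb, p4, p5, p6, p7, -⟩ := hP
    have hbit : (n + 1) * (b.bits n L + 1) + b.bits n L + 2 * L + 3 =
      (fold p x b).bits n L := rfl
    set K := (fold p x b).bits n L with hK
    set g : ℕ → ℕ := fun i => b.eval n (update (reg ∘ ρ) x i) mem with hg
    have hgi : ∀ i < n, g i < 2 ^ b.bits n L := fun i hi =>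
      b.eval_lt hn (update_lt he x (hi.trans hn)) hm
    have hsn := size_le_of_lt hn
    have key : ∀ j ≤ n, ∃ r', Steps P K (2 + j * (b.time n + 5)) ⟨o, reg, mem⟩ ⟨o + 2, r', mem⟩ ∧
        r' t = bigOp p j g ∧ r' (t + 1) = j ∧ ∀ r < t, r' r = reg r := by
      intro j
      induction j with
      | zero =>
        intro _
        refine ⟨update (update reg t (bigUnit p)) (t + 1) 0, ?_, ?_, by simp, ?_⟩
        · have : (bigUnit p).size ≤ 1 := by cases p <;> simp [bigUnit]
          have q1 : Steps P K 1 ⟨o, reg, mem⟩ _ := .const p0 (by omega)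
          have q2 := q1.trans (.const p1 (by simp only [Nat.size_zero]; omega))
          simpa using q2
        · rw [update_of_ne (by omega), update_self, bigOp_zero]
        · intro r hr
          rw [update_of_ne (by omega), update_of_ne (by omega)]
      | succ j ih =>
        intro hj
        obtain ⟨r1, s1, a1, i1, f1⟩ := ih (by omega)
        have hr0 : r1 0 = n := by rw [f1 _ (by omega), h0]
        have hj2 : j < 2 ^ L := by omega
        have hcomp := comp_update_of_lt hρ f1 x (s := t + 1)
        rw [i1] at hcomp
        obtain ⟨r2, s2, v2, f2⟩ := hb (reg := r1) pb (by omega)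
          (update_lt_succ hρ x (by omega)) hr0 hn
          (fun y => by
            rw [← comp_apply (f := r1), hcomp]
            exact update_lt he x hj2 y) hm
        rw [hcomp] at v2
        have hsa : (bigOp p j g).size ≤ (n + 1) * (b.bits n L + 1) := by
          refine (size_le_of_lt (bigOp_lt p j (b.bits n L) fun i hi => hgi i (by omega))).trans ?_
          have : j * (b.bits n L + 1) ≤ n * (b.bits n L + 1) := Nat.mul_le_mul_right _ (by omega)
          rw [add_mul]; omega
        have hsg := size_le_of_lt (hgi j hj)
        have hsj := size_le_of_lt hj2
        have e1 : r2 t = bigOp p j g := by rw [f2 _ (by omega), a1]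
        have e2 : r2 (t + 1) = j := by rw [f2 _ (by omega), i1]
        have e3 : r2 (t + 2) = g j := v2
        set r3 := update r2 t ((bigStep p).eval (r2 t) (r2 (t + 2))) with hr3
        have e4 : r3 (t + 1) = j := by rw [hr3, update_of_ne (by omega), e2]
        refine ⟨update (update r3 (t + 2) 1) (t + 1) (r3 (t + 1) + 1), ?_, ?_, by simp [e4], ?_⟩
        · have q1 : Steps P K 1 ⟨o + 2, r1, mem⟩ ⟨o + 4, r1, mem⟩ :=
            .jumpLt_of_lt p2 (by rw [i1, hr0]; omega) (by omega)
          have q2 := q1.trans (s2.mono (by omega))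
          have q3 : Steps P K 1 ⟨o + 4 + b.len, r2, mem⟩ ⟨o + 4 + b.len + 1, r3, mem⟩ :=
            .op p4 (by rw [e1, e3]; omega)
          have q4 := q3.trans (.incr p5 p6 (by omega) (by rw [e4]; omega))
          have q5 := q4.trans (.jump (K := K) p7 (by omega))
          convert (s1.trans q2).trans q5 using 1
          ring
        · rw [update_of_ne (by omega), update_of_ne (by omega), hr3, update_self, bigOp_succ, e1,
            e3]
        · intro r hr
          rw [update_of_ne (by omega), update_of_ne (by omega), hr3, update_of_ne (by omega),
            f2 _ (by omega), f1 _ hr]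
    obtain ⟨r1, s1, a1, i1, f1⟩ := key n le_rfl
    have hr0 : r1 0 = n := by rw [f1 _ (by omega), h0]
    refine ⟨r1, ?_, a1, f1⟩
    have q1 : Steps P K 1 ⟨o + 2, r1, mem⟩ ⟨o + 3, r1, mem⟩ :=
      .jumpLt_of_not_lt p2 (by rw [i1, hr0]; omega) (by omega)
    have q2 := (s1.trans q1).trans (.jump (K := K) p3 (by omega))
    convert q2 using 1
    · simp only [time]; ring
    · simp only [len, add_assoc]

/-! ### Commands -/

/-- Commands of a small imperative language. Variables are bound by `letC` and `loop` and are
not assigned to afterwards, so that a command changes nothing but the memory. -/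
inductive Cmd where
  /-- write the value of `b` into the memory cell whose address is the value of `a` -/
  | store (a b : Expr)
  | seq (c d : Cmd)
  /-- run `c` where `x` stands for the value of `a` -/
  | letC (x : ℕ) (a : Expr) (c : Cmd)
  /-- run `c` for `x = 0, …, N - 1`, where `N` is the value of `a` -/
  | loop (x : ℕ) (a : Expr) (c : Cmd)

/-- The composition of `f 0, …, f (N - 1)`, where `f 0` acts first. -/
def iterMem (f : ℕ → (ℕ → ℕ) → ℕ → ℕ) : ℕ → (ℕ → ℕ) → ℕ → ℕ
  | 0, mem => mem
  | j + 1, mem => f j (iterMem f j mem)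

namespace Cmd

/-- The memory after the command. -/
def exec (n : ℕ) : Cmd → (ℕ → ℕ) → (ℕ → ℕ) → (ℕ → ℕ)
  | store a b, env, mem => update mem (a.eval n env mem) (b.eval n env mem)
  | seq c d, env, mem => d.exec n env (c.exec n env mem)
  | letC x a c, env, mem => c.exec n (update env x (a.eval n env mem)) mem
  | loop x a c, env, mem =>
    iterMem (fun i m => c.exec n (update env x i) m) (a.eval n env mem) mem

/-- The number of steps that the compiled command takes. -/
def time (n : ℕ) : Cmd → (ℕ → ℕ) → (ℕ → ℕ) → ℕ
  | store a b, _, _ => a.time n + b.time n + 1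
  | seq c d, env, mem => c.time n env mem + d.time n env (c.exec n env mem)
  | letC x a c, env, mem => a.time n + c.time n (update env x (a.eval n env mem)) mem
  | loop x a c, env, mem => a.time n + 3 + ∑ j ∈ Finset.range (a.eval n env mem),
      (c.time n (update env x j)
        (iterMem (fun i m => c.exec n (update env x i) m) j mem) + 4)

/-- A bound on the logarithmic cost of every step, provided that all variables and memory cells
have at most `L` bits throughout. -/
def bits (n L : ℕ) : Cmd → ℕ
  | store a b => a.bits n L + b.bits n L + 1
  | seq c d => c.bits n L + d.bits n L
  | letC _ a c => a.bits n L + c.bits n L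
  | loop _ a c => a.bits n L + c.bits n L + 2 * L + 3

/-- All values that the command stores, binds or uses as the bound of a loop have at most `L`
bits. -/
def Safe (n L : ℕ) : Cmd → (ℕ → ℕ) → (ℕ → ℕ) → Prop
  | store _ b, env, mem => b.eval n env mem < 2 ^ L
  | seq c d, env, mem => c.Safe n L env mem ∧ d.Safe n L env (c.exec n env mem)
  | letC x a c, env, mem =>
    a.eval n env mem < 2 ^ L ∧ c.Safe n L (update env x (a.eval n env mem)) mem
  | loop x a c, env, mem => a.eval n env mem < 2 ^ L ∧ ∀ j < a.eval n env mem,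
      c.Safe n L (update env x j) (iterMem (fun i m => c.exec n (update env x i) m) j mem)

theorem polyBounded_bits (c : Cmd) : PolyBounded fun n L => c.bits n L := by
  induction c with
  | store a b => exact (a.polyBounded_bits.add b.polyBounded_bits).add (.const 1)
  | seq c d hc hd => exact hc.add hd
  | letC x a c hc => exact a.polyBounded_bits.add hc
  | loop x a c hc =>
    exact ((a.polyBounded_bits.add hc).add ((PolyBounded.const 2).mul .snd)).add (.const 3)

theorem exec_lt {n L : ℕ} (c : Cmd) : ∀ {env mem : ℕ → ℕ}, c.Safe n L env mem →
    (∀ a, mem a < 2 ^ L) → ∀ a, c.exec n env mem a < 2 ^ L := by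
  induction c with
  | store a b => exact fun hs hm => update_lt hm _ hs
  | seq c d hc hd => exact fun hs hm => hd hs.2 (hc hs.1 hm)
  | letC x a c hc => exact fun hs hm => hc hs.2 hm
  | loop x a c hc =>
    intro env mem hs hm
    have key : ∀ j ≤ a.eval n env mem, ∀ y,
        iterMem (fun i m => c.exec n (update env x i) m) j mem y < 2 ^ L := by
      intro j
      induction j with
      | zero => exact fun _ => hm
      | succ j ih => exact fun hj => hc (hs.2 j (by omega)) (ih (by omega))
    exact key _ le_rfl

/-! ### Compiling commands -/

/-- The number of instructions of the compiled command. -/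
def len : Cmd → ℕ
  | store a b => a.len + b.len + 1
  | seq c d => c.len + d.len
  | letC _ a c => a.len + c.len
  | loop _ a c => a.len + c.len + 6

/-- Code that stands at position `o` and executes the command; see `Expr.compile` for the roles
of `ρ` and `t`. -/
def compile : Cmd → (ρ : ℕ → ℕ) → (t o : ℕ) → List Instr
  | store a b, ρ, t, o =>
    a.compile ρ t o ++ (b.compile ρ (t + 1) (o + a.len) ++ [.store t (t + 1)])
  | seq c d, ρ, t, o => c.compile ρ t o ++ d.compile ρ t (o + c.len)
  | letC x a c, ρ, t, o => a.compile ρ t o ++ c.compile (update ρ x t) (t + 1) (o + a.len)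
  | loop x a c, ρ, t, o =>
    a.compile ρ t o ++ ([.const (t + 1) 0, .jumpLt (t + 1) t (o + a.len + 3),
      .jump (o + a.len + c.len + 6)] ++
      (c.compile (update ρ x (t + 1)) (t + 2) (o + a.len + 3) ++
        [.const (t + 2) 1, .add (t + 1) (t + 1) (t + 2), .jump (o + a.len + 1)]))

theorem length_compile (c : Cmd) : ∀ ρ t o, (c.compile ρ t o).length = c.len := by
  induction c with
  | store a b => intros; simp [compile, len, Expr.length_compile, add_assoc]
  | seq c d hc hd => intros; simp [compile, len, hc, hd]
  | letC x a c hc => intros; simp [compile, len, Expr.length_compile, hc]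
  | loop x a c hc => intros; simp [compile, len, Expr.length_compile, hc]; omega

/-- The compiled command has the effect described by `Cmd.exec`, in the time and with the cost
announced by `Cmd.time` and `Cmd.bits`. -/
theorem steps_compile {P : Program} {n L : ℕ} (hn : n < 2 ^ L) (c : Cmd) :
    ∀ {t o : ℕ} {ρ reg mem : ℕ → ℕ}, CodeAt P o (c.compile ρ t o) → 1 ≤ t → (∀ x, ρ x < t) →
      reg 0 = n → (∀ x, reg (ρ x) < 2 ^ L) → (∀ a, mem a < 2 ^ L) → c.Safe n L (reg ∘ ρ) mem →
      ∃ reg', Steps P (c.bits n L) (c.time n (reg ∘ ρ) mem) ⟨o, reg, mem⟩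
        ⟨o + c.len, reg', c.exec n (reg ∘ ρ) mem⟩ ∧ ∀ r < t, reg' r = reg r := by
  induction c with
  | store a b =>
    intro t o ρ reg mem hP ht hρ h0 he hm hs
    simp only [compile, codeAt_append, Expr.length_compile, codeAt_cons] at hP
    obtain ⟨r1, s1, v1, f1⟩ := a.steps_compile hP.1 ht hρ h0 hn he hm
    have hcomp : r1 ∘ ρ = reg ∘ ρ := funext fun x => f1 _ (hρ x)
    obtain ⟨r2, s2, v2, f2⟩ := b.steps_compile (reg := r1) hP.2.1 (by omega)
      (fun x => (hρ x).trans (by omega)) (by rw [f1 _ (by omega), h0]) hn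
      (fun x => by rw [f1 _ (hρ x)]; exact he x) hm
    rw [hcomp] at v2
    have h1 := size_le_of_lt (a.eval_lt (env := reg ∘ ρ) hn he hm)
    have h2 := size_le_of_lt (b.eval_lt (env := reg ∘ ρ) hn he hm)
    have e1 : r2 t = a.eval n (reg ∘ ρ) mem := by rw [f2 _ (by omega), v1]
    rw [← e1] at h1
    rw [← v2] at h2
    refine ⟨r2, ?_, fun r hr => by rw [f2 _ (by omega), f1 _ hr]⟩
    have q1 := s1.mono (K' := (store a b).bits n L) (by simp only [bits]; omega)
    have q2 := s2.mono (K' := (store a b).bits n L) (by simp only [bits]; omega)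
    have q3 := (q1.trans q2).trans (.store hP.2.2.1 (by simp only [bits]; omega))
    rw [e1, v2] at q3
    simpa only [len, time, exec, add_assoc] using q3
  | seq c d hc hd =>
    intro t o ρ reg mem hP ht hρ h0 he hm hs
    simp only [compile, codeAt_append, length_compile] at hP
    obtain ⟨r1, s1, f1⟩ := hc hP.1 ht hρ h0 he hm hs.1
    have hcomp : r1 ∘ ρ = reg ∘ ρ := funext fun x => f1 _ (hρ x)
    obtain ⟨r2, s2, f2⟩ := hd (reg := r1) hP.2 ht hρ (by rw [f1 _ (by omega), h0])
      (fun x => by rw [f1 _ (hρ x)]; exact he x) (c.exec_lt hs.1 hm) (by rw [hcomp]; exact hs.2)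
    rw [hcomp] at s2
    refine ⟨r2, ?_, fun r hr => by rw [f2 _ hr, f1 _ hr]⟩
    have q1 := s1.mono (K' := (seq c d).bits n L) (by simp only [bits]; omega)
    have q2 := s2.mono (K' := (seq c d).bits n L) (by simp only [bits]; omega)
    simpa only [len, time, exec, add_assoc] using q1.trans q2
  | letC x a c hc =>
    intro t o ρ reg mem hP ht hρ h0 he hm hs
    simp only [compile, codeAt_append, Expr.length_compile] at hP
    obtain ⟨r1, s1, v1, f1⟩ := a.steps_compile hP.1 ht hρ h0 hn he hm
    have hcomp := comp_update_of_lt hρ f1 x (s := t)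
    rw [v1] at hcomp
    obtain ⟨r2, s2, f2⟩ := hc (reg := r1) hP.2 (by omega)
      (update_lt_succ hρ x le_rfl) (by rw [f1 _ (by omega), h0])
      (fun y => by rw [← comp_apply (f := r1), hcomp]; exact update_lt he x hs.1 y) hm
      (by rw [hcomp]; exact hs.2)
    rw [hcomp] at s2
    refine ⟨r2, ?_, fun r hr => by rw [f2 _ (by omega), f1 _ hr]⟩
    have q1 := s1.mono (K' := (letC x a c).bits n L) (by simp only [bits]; omega)
    have q2 := s2.mono (K' := (letC x a c).bits n L) (by simp only [bits]; omega)
    simpa only [len, time, exec, add_assoc] using q1.trans q2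
  | loop x a c hc =>
    intro t o ρ reg mem hP ht hρ h0 he hm hs
    simp only [compile, codeAt_append, Expr.length_compile, length_compile, codeAt_cons,
      List.length_cons, List.length_nil] at hP
    obtain ⟨pa, ⟨p0, p1, p2, -⟩, pb, p4, p5, p6, -⟩ := hP
    obtain ⟨r0, s0, v0, f0⟩ := a.steps_compile pa ht hρ h0 hn he hm
    obtain ⟨hN, hsafe⟩ := hs
    have hbit : a.bits n L + c.bits n L + 2 * L + 3 = (loop x a c).bits n L := rfl
    set K := (loop x a c).bits n L
    simp only [time, exec]
    set f : ℕ → (ℕ → ℕ) → ℕ → ℕ := fun i m => c.exec n (update (reg ∘ ρ) x i) m with hf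
    set N := a.eval n (reg ∘ ρ) mem
    have hsN := size_le_of_lt hN
    have hmem : ∀ j ≤ N, ∀ y, iterMem f j mem y < 2 ^ L := by
      intro j
      induction j with
      | zero => exact fun _ => hm
      | succ j ih => exact fun hj => c.exec_lt (hsafe j (by omega)) (ih (by omega))
    have key : ∀ j ≤ N, ∃ r', Steps P K (a.time n + 1 + ∑ i ∈ Finset.range j,
          (c.time n (update (reg ∘ ρ) x i) (iterMem f i mem) + 4)) ⟨o, reg, mem⟩
          ⟨o + a.len + 1, r', iterMem f j mem⟩ ∧
        r' t = N ∧ r' (t + 1) = j ∧ ∀ r < t, r' r = reg r := by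
      intro j
      induction j with
      | zero =>
        intro _
        refine ⟨update r0 (t + 1) 0, ?_, ?_, by simp, ?_⟩
        · exact (s0.mono (by omega)).trans (.const p0 (by simp only [Nat.size_zero]; omega))
        · rw [update_of_ne (by omega), v0]
        · intro r hr
          rw [update_of_ne (by omega), f0 _ hr]
      | succ j ih =>
        intro hj
        obtain ⟨r1, s1, a1, i1, f1⟩ := ih (by omega)
        have hr0 : r1 0 = n := by rw [f1 _ (by omega), h0]
        have hj2 : j < 2 ^ L := by omega
        have hsj := size_le_of_lt hj2
        have hcomp := comp_update_of_lt hρ f1 x (s := t + 1)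
        rw [i1] at hcomp
        obtain ⟨r2, s2, f2⟩ := hc (reg := r1) pb (by omega)
          (update_lt_succ hρ x (by omega)) hr0
          (fun y => by
            rw [← comp_apply (f := r1), hcomp]
            exact update_lt he x hj2 y) (hmem j (by omega))
          (by rw [hcomp]; exact hsafe j (by omega))
        rw [hcomp] at s2
        have e1 : r2 t = N := by rw [f2 _ (by omega), a1]
        have e2 : r2 (t + 1) = j := by rw [f2 _ (by omega), i1]
        refine ⟨update (update r2 (t + 2) 1) (t + 1) (r2 (t + 1) + 1), ?_, ?_, by simp [e2], ?_⟩
        · have q1 : Steps P K 1 ⟨o + a.len + 1, r1, iterMem f j mem⟩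
              ⟨o + a.len + 3, r1, iterMem f j mem⟩ :=
            .jumpLt_of_lt p1 (by rw [i1, a1]; omega) (by omega)
          have q2 := q1.trans (s2.mono (by omega))
          have q3 : Steps P K 2 ⟨o + a.len + 3 + c.len, r2, iterMem f (j + 1) mem⟩ _ :=
            .incr p4 p5 (by omega) (by rw [e2]; omega)
          have q4 := q3.trans (.jump (K := K) p6 (by omega))
          convert (s1.trans q2).trans q4 using 1
          rw [Finset.sum_range_succ]
          ring
        · rw [update_of_ne (by omega), update_of_ne (by omega), e1]
        · intro r hr
          rw [update_of_ne (by omega), update_of_ne (by omega), f2 _ (by omega), f1 _ hr]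
    obtain ⟨r1, s1, a1, i1, f1⟩ := key N le_rfl
    refine ⟨r1, ?_, f1⟩
    have q1 : Steps P K 1 ⟨o + a.len + 1, r1, iterMem f N mem⟩
        ⟨o + a.len + 2, r1, iterMem f N mem⟩ :=
      .jumpLt_of_not_lt p1 (by rw [i1, a1]; omega) (by omega)
    have q2 := (s1.trans q1).trans (.jump (K := K) p2 (by omega))
    convert q2 using 1
    · ring
    · simp only [len, add_assoc]

end Cmd

/-- The program that reads the size parameter from memory cell `0` and then executes the command
`c`; the variables that `c` does not bind have the value of the size parameter. -/
def Cmd.program (c : Cmd) : Program := .load 0 0 :: c.compile (fun _ => 0) 1 1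

/-- A run of the program `c.program` from an initial configuration. -/
theorem Cmd.run_program (c : Cmd) {x : List ℕ} {n L : ℕ} (hx : x.getD 0 0 = n)
    (hL : ∀ a, x.getD a 0 < 2 ^ L) (hs : c.Safe n L (fun _ => n) fun a => x.getD a 0) :
    ∃ s ≤ c.time n (fun _ => n) (fun a => x.getD a 0) + 1,
      c.program.Halted (c.program.run s (Program.init x)) ∧
      c.program.logCost s (Program.init x) ≤ s * (c.bits n L + L + 1) ∧
      (c.program.run s (Program.init x)).mem = c.exec n (fun _ => n) fun a => x.getD a 0 := by
  have hn : n < 2 ^ L := hx ▸ hL 0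
  have hcode : CodeAt c.program 0 (.load 0 0 :: c.compile (fun _ => 0) 1 1) := by
    intro i hi
    rw [zero_add]
    exact List.getElem?_eq_getElem hi
  rw [codeAt_cons] at hcode
  have s1 : Steps c.program (c.bits n L + L + 1) 1 (Program.init x) _ :=
    .load (reg := fun _ => 0) (mem := fun a => x.getD a 0) hcode.1 (by
      have := size_le_of_lt (hL 0)
      simp only [Nat.size_zero]; omega)
  obtain ⟨r2, s2, -⟩ := c.steps_compile hn (reg := update (fun _ => 0) 0 (x.getD 0 0))
    hcode.2 le_rfl (by simp) (by rw [update_self, hx])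
    (fun _ => by rw [update_self, hx]; exact hn) hL
    (by simpa only [comp_def, update_self, hx] using hs)
  have s3 := s1.trans (s2.mono (by omega))
  simp only [comp_def, update_self, hx] at s3
  refine ⟨_, (add_comm _ _).le, ?_, ?_, by rw [s3.1]⟩
  · rw [s3.1]
    simp [Program.Halted, program, length_compile]
  · rw [Program.logCost]
    refine (Finset.sum_le_card_nsmul _ _ _ fun i hi => s3.2 i (Finset.mem_range.1 hi)).trans ?_
    simp

/-! ### Derived expressions

Variables are numbered by hand, and no bound variable is used for two purposes at a time: `1` is the
code of a sequence, `2` the code of a vertex order, `3` the bound `W` on the number of signatures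
per set of houses, `4` and `5` are the loop variables of the search, `6`, `8`, `9` its intermediate
values, and the larger numbers are bound inside of derived expressions and in `outputCmd`. -/

namespace Expr

instance : Add Expr := ⟨op .add⟩
instance : Sub Expr := ⟨op .sub⟩
instance : Mul Expr := ⟨op .mul⟩
instance : Div Expr := ⟨op .div⟩
instance : Zero Expr := ⟨const 0⟩
instance : One Expr := ⟨const 1⟩

/-- The sum of `b` over `x < n`. -/
abbrev sum (x : ℕ) (b : Expr) : Expr := fold false x b

/-- The product of `b` over `x < n`. -/
abbrev prod (x : ℕ) (b : Expr) : Expr := fold true x b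

/-- `1` if `a < b`, and `0` otherwise. -/
def lt (a b : Expr) : Expr := 1 - (1 - (b - a))

/-- `1` if `a = b`, and `0` otherwise. -/
def eq (a b : Expr) : Expr := 1 - ((a - b) + (b - a))

/-- `a` if `c ≠ 0`, and `b` otherwise. -/
def ite (c a b : Expr) : Expr := lt 0 c * a + (1 - c) * b

/-- The minimum of `a` and `b`. -/
def min (a b : Expr) : Expr := a - (a - b)

/-- The remainder of `a` modulo `b`. -/
def mod (a b : Expr) : Expr := a - a / b * b

/-- The power `a ^ b`, for `b ≤ n`. The expression `a` must not contain variables, since it is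
evaluated where `100` and `101` are bound. -/
def pow (a b : Expr) : Expr :=
  letE 100 b (prod 101 (ite (lt (var 101) (var 100)) a 1))

/-- A power of `n + 1`. -/
def powB (b : Expr) : Expr := pow (size + 1) b

/-- The digit number `j < n` of `p` in base `n + 1`. -/
def digit (p j : Expr) : Expr := mod (p / powB j) (size + 1)

variable {n : ℕ} {env mem : ℕ → ℕ} {a b c : Expr}

@[simp] theorem eval_size : size.eval n env mem = n := rfl

@[simp] theorem eval_var (x : ℕ) : (var x).eval n env mem = env x := rfl

@[simp] theorem eval_load : (load a).eval n env mem = mem (a.eval n env mem) := rfl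

@[simp] theorem eval_letE (x : ℕ) : (letE x a b).eval n env mem =
    b.eval n (update env x (a.eval n env mem)) mem := rfl

@[simp] theorem eval_zero : (0 : Expr).eval n env mem = 0 := rfl

@[simp] theorem eval_one : (1 : Expr).eval n env mem = 1 := rfl

@[simp] theorem eval_add : (a + b).eval n env mem = a.eval n env mem + b.eval n env mem := rfl

@[simp] theorem eval_sub : (a - b).eval n env mem = a.eval n env mem - b.eval n env mem := rfl

@[simp] theorem eval_mul : (a * b).eval n env mem = a.eval n env mem * b.eval n env mem := rfl

@[simp] theorem eval_div : (a / b).eval n env mem = a.eval n env mem / b.eval n env mem := rfl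

@[simp] theorem eval_sum (x : ℕ) : (sum x b).eval n env mem =
    ∑ i ∈ Finset.range n, b.eval n (update env x i) mem := rfl

@[simp] theorem eval_prod (x : ℕ) : (prod x b).eval n env mem =
    ∏ i ∈ Finset.range n, b.eval n (update env x i) mem := rfl

@[simp] theorem eval_lt' : (lt a b).eval n env mem =
    if a.eval n env mem < b.eval n env mem then 1 else 0 := by
  simp only [lt, eval_sub, eval_one]
  split_ifs <;> omega

@[simp] theorem eval_eq : (eq a b).eval n env mem =
    if a.eval n env mem = b.eval n env mem then 1 else 0 := by
  simp only [eq, eval_sub, eval_one, eval_add]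
  split_ifs <;> omega

@[simp] theorem eval_ite : (ite c a b).eval n env mem =
    if c.eval n env mem ≠ 0 then a.eval n env mem else b.eval n env mem := by
  simp only [ite, eval_add, eval_mul, eval_lt', eval_sub, eval_one, eval_zero, Nat.pos_iff_ne_zero]
  split_ifs with h
  · simp [show 1 - c.eval n env mem = 0 by omega]
  · rw [ne_eq, not_not] at h
    simp [h]

@[simp] theorem eval_min : (min a b).eval n env mem =
    Min.min (a.eval n env mem) (b.eval n env mem) := by
  simp only [min, eval_sub]; omega

@[simp] theorem eval_mod : (mod a b).eval n env mem =
    a.eval n env mem % b.eval n env mem := by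
  simp only [mod, eval_sub, eval_mul, eval_div]
  exact (Nat.mod_eq_sub_div_mul).symm

theorem prod_range_ite_lt (n k c : ℕ) :
    ∏ i ∈ Finset.range n, (if i < k then c else 1) = c ^ Min.min k n := by
  induction n with
  | zero => simp
  | succ n ih =>
    rw [Finset.prod_range_succ, ih]
    split_ifs with h
    · rw [← pow_succ]; congr 1; omega
    · rw [mul_one]; congr 1; omega

theorem eval_pow {k : ℕ} (ha : ∀ env, a.eval n env mem = k) : (pow a b).eval n env mem =
    k ^ Min.min (b.eval n env mem) n := by
  simp [pow, ha, prod_range_ite_lt]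

@[simp] theorem eval_powB : (powB b).eval n env mem =
    (n + 1) ^ Min.min (b.eval n env mem) n :=
  eval_pow fun _ => rfl

@[simp] theorem eval_pow_const (k : ℕ) : (pow (const k) b).eval n env mem =
    k ^ Min.min (b.eval n env mem) n :=
  eval_pow fun _ => rfl

@[simp] theorem eval_digit : (digit a b).eval n env mem =
    a.eval n env mem / (n + 1) ^ Min.min (b.eval n env mem) n % (n + 1) := by
  simp [digit]

end Expr

/-! ### Sequences as numbers -/

section Code

variable {n : ℕ}

/-- A sequence of elements of `Fin n` as a number in base `n + 1`: the digits are the elements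
plus one, so that the length of the sequence can be recovered. -/
def code : List (Fin n) → ℕ
  | [] => 0
  | a :: l => (a + 1) + (n + 1) * code l

/-- The digit number `j` of `code l`. -/
def digitAt (l : List (Fin n)) (j : ℕ) : ℕ := (l[j]?).elim 0 fun h => h.val + 1

theorem code_div_mod (l : List (Fin n)) (j : ℕ) :
    code l / (n + 1) ^ j % (n + 1) = digitAt l j := by
  induction l generalizing j with
  | nil => simp [code, digitAt]
  | cons a l ih =>
    cases j with
    | zero => simp [code, digitAt]
    | succ j =>
      have ha : (a : ℕ) + 1 < n + 1 := by omega
      rw [pow_succ', ← Nat.div_div_eq_div_mul, code, Nat.add_mul_div_left _ _ (by omega),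
        Nat.div_eq_of_lt ha, zero_add, ih]
      simp [digitAt]

theorem code_append_singleton (l : List (Fin n)) (h : Fin n) :
    code (l ++ [h]) = code l + (h + 1) * (n + 1) ^ l.length := by
  induction l with
  | nil => simp [code]
  | cons a l ih =>
    rw [List.cons_append, code, ih, code, List.length_cons, pow_succ]
    ring

theorem code_lt (l : List (Fin n)) : code l < (n + 1) ^ l.length := by
  induction l with
  | nil => simp [code]
  | cons a l ih =>
    rw [code, List.length_cons, pow_succ]
    have := a.2
    nlinarith

theorem length_le_of_nodup {l : List (Fin n)} (hl : l.Nodup) : l.length ≤ n := by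
  simpa using hl.length_le_card

theorem code_lt_of_nodup {l : List (Fin n)} (hl : l.Nodup) : code l < (n + 1) ^ n :=
  (code_lt l).trans_le (Nat.pow_le_pow_right (by omega) (length_le_of_nodup hl))

theorem digitAt_pos {l : List (Fin n)} {j : ℕ} : 0 < digitAt l j ↔ j < l.length := by
  rw [digitAt]
  by_cases hj : j < l.length
  · simp [hj]
  · simp [hj]

theorem digitAt_eq {l : List (Fin n)} {j : ℕ} {v : Fin n} :
    digitAt l j = v + 1 ↔ l[j]? = some v := by
  rw [digitAt]
  cases h : l[j]? with
  | none => simp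
  | some a => simp [Fin.ext_iff]

theorem card_digitAt_pos {l : List (Fin n)} (hl : l.length ≤ n) :
    ∑ j ∈ Finset.range n, (if 0 < digitAt l j then 1 else 0) = l.length := by
  simp only [digitAt_pos]
  rw [Finset.sum_boole, show (Finset.range n).filter (· < l.length) = Finset.range l.length by
    ext; simp; omega]
  simp

theorem sum_digitAt (f : ℕ → ℕ) (hf : f 0 = 0) {l : List (Fin n)} (hl : l.length ≤ n) :
    ∑ j ∈ Finset.range n, f (digitAt l j) = (l.map fun h : Fin n => f (h.val + 1)).sum := by
  have key : ∀ m, ∀ l : List (Fin n), l.length ≤ m →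
      ∑ j ∈ Finset.range m, f (digitAt l j) = (l.map fun h : Fin n => f (h.val + 1)).sum := by
    intro m
    induction m with
    | zero =>
      intro l hl
      obtain rfl : l = [] := List.eq_nil_of_length_eq_zero (by omega)
      simp
    | succ m ih =>
      intro l hl
      cases l with
      | nil => simp [digitAt, hf]
      | cons a l =>
        rw [Finset.sum_range_succ', List.map_cons, List.sum_cons,
          ← ih l (by simpa using hl), add_comm]
        simp [digitAt]
  exact key n l hl

theorem exists_digitAt {l : List (Fin n)} (hl : l.length ≤ n) {m : ℕ} {v : Fin n} :
    (∃ j < n, j < m ∧ digitAt l j = v + 1) ↔ v ∈ l.take m := by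
  simp only [digitAt_eq, List.mem_take_iff_getElem]
  constructor
  · rintro ⟨j, -, hj, h⟩
    obtain ⟨h1, h2⟩ := List.getElem?_eq_some_iff.1 h
    exact ⟨j, by omega, h2⟩
  · rintro ⟨j, hj, h⟩
    exact ⟨j, by omega, by omega, List.getElem?_eq_some_iff.2 ⟨by omega, h⟩⟩

end Code

namespace Expr

variable {n : ℕ} {env mem : ℕ → ℕ}

theorem eval_digit_code {l : List (Fin n)} {a b : Expr} (ha : a.eval n env mem = code l)
    (hb : b.eval n env mem < n) :
    (digit a b).eval n env mem = digitAt l (b.eval n env mem) := by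
  rw [eval_digit, ha, min_eq_left hb.le, code_div_mod]

/-- The length of the sequence whose code is the variable `c`. -/
def length (c : ℕ) : Expr := sum 20 (lt 0 (digit (var c) (var 20)))

theorem eval_length {c : ℕ} (hc : c ≠ 20) {l : List (Fin n)} (hl : l.length ≤ n)
    (h : env c = code l) : (length c).eval n env mem = l.length := by
  rw [length, eval_sum, ← card_digitAt_pos hl]
  refine Finset.sum_congr rfl fun j hj => ?_
  rw [eval_lt', eval_digit_code (l := l) (by simp [hc, h])
    (by simpa using Finset.mem_range.1 hj)]
  simp

/-- Whether the value of the variable `v` is among the first `m` elements of the sequence whose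
code is the variable `c`; here `m` is a variable, too. -/
def memTake (c m v : ℕ) : Expr :=
  lt 0 (sum 20 (lt (var 20) (var m) * eq (digit (var c) (var 20)) (var v + 1)))

theorem eval_memTake {c m v : ℕ} (hc : c ≠ 20) (hm : m ≠ 20) (hv : v ≠ 20) {l : List (Fin n)}
    (hl : l.length ≤ n) (h : env c = code l) {u : Fin n} (hu : env v = u) :
    (memTake c m v).eval n env mem = if u ∈ l.take (env m) then 1 else 0 := by
  rw [memTake, eval_lt', eval_sum]
  refine if_congr ?_ rfl rfl
  rw [← exists_digitAt hl, eval_zero, Finset.sum_pos_iff]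
  refine exists_congr fun j => ?_
  rw [Finset.mem_range]
  refine and_congr_right fun hj => ?_
  rw [eval_mul, eval_eq, eval_digit_code (l := l) (by simp [hc, h]) (by simpa using hj)]
  simp only [eval_lt', eval_var, update_self, update_of_ne hm, update_of_ne hv, hu, eval_add,
    eval_one]
  split_ifs <;> simp_all

end Expr

/-! ### Dynamic programming with dominance -/

/-- The condition under which, among all sequences of the same signature, only a cheapest one has
to be kept: an extension of the kept sequence is possible, has the same signature, and is not more
expensive. Signatures grow with the sequence. -/
structure Dominance {n : ℕ} (sig cost : List (Fin n) → ℕ) : Prop where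
  sig_nil : sig [] = 0
  sig_lt : ∀ l h, (l ++ [h]).Nodup → sig l < sig (l ++ [h])
  extend : ∀ l l' h, l.Nodup → (l' ++ [h]).Nodup → sig l = sig l' → cost l ≤ cost l' →
    (l ++ [h]).Nodup ∧ sig (l ++ [h]) = sig (l' ++ [h]) ∧ cost (l ++ [h]) ≤ cost (l' ++ [h])

theorem nodup_append_singleton {α : Type*} {l : List α} {a : α} :
    (l ++ [a]).Nodup ↔ l.Nodup ∧ a ∉ l := by
  rw [← List.concat_eq_append, List.nodup_concat, and_comm]

section Table

variable {n : ℕ} {sig cost : List (Fin n) → ℕ} {T T' : ℕ → Option (List (Fin n))}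

/-- Every entry of the table is a sequence without repetitions, filed under its signature. -/
def ValidTable (sig : List (Fin n) → ℕ) (T : ℕ → Option (List (Fin n))) : Prop :=
  ∀ s l, T s = some l → l.Nodup ∧ sig l = s

/-- The table holds a sequence of the same signature as `l` that is not more expensive. -/
def Covers (sig cost : List (Fin n) → ℕ) (T : ℕ → Option (List (Fin n)))
    (l : List (Fin n)) : Prop :=
  ∃ l', T (sig l) = some l' ∧ cost l' ≤ cost l

open Classical in
/-- Enter `l` into the table, unless the table has an entry that is as good. -/
noncomputable def enter (sig cost : List (Fin n) → ℕ) (T : ℕ → Option (List (Fin n)))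
    (l : List (Fin n)) : ℕ → Option (List (Fin n)) :=
  if Covers sig cost T l then T else update T (sig l) (some l)

theorem ValidTable.enter (hT : ValidTable sig T) {l : List (Fin n)} (hl : l.Nodup) :
    ValidTable sig (enter sig cost T l) := by
  unfold MEGHA.enter
  split_ifs
  · exact hT
  · intro s l' h
    by_cases hs : s = sig l
    · subst hs
      rw [update_self, Option.some_inj] at h
      exact h ▸ ⟨hl, rfl⟩
    · rw [update_of_ne hs] at h
      exact hT s l' h

theorem covers_enter_self (l : List (Fin n)) : Covers sig cost (enter sig cost T l) l := by
  unfold enter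
  split_ifs with h
  · exact h
  · exact ⟨l, update_self _ _ _, le_rfl⟩

theorem Covers.enter {l' : List (Fin n)} (h : Covers sig cost T l') (l : List (Fin n)) :
    Covers sig cost (enter sig cost T l) l' := by
  unfold MEGHA.enter
  split_ifs with hl
  · exact h
  · obtain ⟨l₁, h₁, h₂⟩ := h
    by_cases hs : sig l' = sig l
    · refine ⟨l, by rw [hs, update_self], le_of_lt ?_⟩
      by_contra hc
      exact hl ⟨l₁, by rw [← hs, h₁], h₂.trans (not_lt.1 hc)⟩
    · exact ⟨l₁, by rw [update_of_ne hs, h₁], h₂⟩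

theorem enter_of_ne {l : List (Fin n)} {s : ℕ} (h : s ≠ sig l) : enter sig cost T l s = T s := by
  unfold enter
  split_ifs
  · rfl
  · exact update_of_ne h _ _

/-- The memory `mem` holds the table `T` from address `a` on, and agrees with `mem₀` below. -/
def Represents (a : ℕ) (mem₀ mem : ℕ → ℕ) (T : ℕ → Option (List (Fin n))) : Prop :=
  (∀ x < a, mem x = mem₀ x) ∧ ∀ s, mem (a + s) = (T s).elim 0 fun l => code l + 1

/-- The value of `e` is `f l`, where variable `1` is the code of `l`. The variables `2` and `3`,
and the memory below `a`, are as in `env₀` and `mem₀`. -/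
def Computes (a : ℕ) (env₀ mem₀ : ℕ → ℕ) (e : Expr) (f : List (Fin n) → ℕ) : Prop :=
  ∀ (env mem : ℕ → ℕ) (l : List (Fin n)), l.Nodup → env 1 = code l → env 2 = env₀ 2 →
    env 3 = env₀ 3 → (∀ x < a, mem x = mem₀ x) → e.eval n env mem = f l

end Table

namespace Search

open MEGHA.Expr

/-- The value of `e`, where variable `1` is the extension of the sequence in the table cell
number `var 4` by the element `var 5`. Variable `6` is the content of that cell. -/
def extended (A e : Expr) : Expr :=
  letE 6 (load (A + var 4))
    (letE 1 (var 6 - 1 + (var 5 + 1) * powB (letE 1 (var 6 - 1) (length 1))) e)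

/-- The element `var 5` occurs in the sequence of the cell `var 6`. -/
def used : Expr := letE 1 (var 6 - 1) (letE 9 size (memTake 1 9 5))

/-- The new content of the cell with the address `A + sig`. The sequence is entered if the cell
`var 4` is not empty, the element `var 5` does not occur in its sequence, and the target cell
is empty or contains a more expensive sequence. The minimum changes nothing for a sequence without
repetitions; it serves to bound the memory contents without an invariant. -/
def newValue (A sig cost : Expr) : Expr :=
  letE 8 (load (A + sig))
    (ite (var 6 * (1 - used) * ite (var 8) (lt cost (letE 1 (var 8 - 1) cost)) 1)
      (min (var 1 + 1) (powB size)) (var 8))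

/-- Enter the extension of the sequence number `var 4` by the element `var 5` into the table. -/
def body (A sig cost : Expr) : Cmd :=
  .store (extended A (A + sig)) (extended A (newValue A sig cost))

/-- Fill a table of cheapest sequences for all signatures. The table starts at address `A`, and
the signatures of sequences that have an extension are less than `M`. -/
def cmd (A M sig cost : Expr) : Cmd :=
  .seq (.store A 1) (.loop 4 M (.loop 5 size (body A sig cost)))

variable {n a : ℕ} {env₀ mem₀ : ℕ → ℕ} {A M sigE costE : Expr} {sig cost : List (Fin n) → ℕ}

/-- The body of the loops enters the extension of the sequence in cell `env 4` by the element `h` into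
the table, provided that the cell is not empty and that `h` does not occur in its sequence. -/
theorem exec_body (hA : ∀ env mem, A.eval n env mem = a)
    (hsig : Computes a env₀ mem₀ sigE sig) (hcost : Computes a env₀ mem₀ costE cost)
    {env mem : ℕ → ℕ} {T : ℕ → Option (List (Fin n))} (hT : ValidTable sig T)
    (hmem : Represents a mem₀ mem T) (h2 : env 2 = env₀ 2) (h3 : env 3 = env₀ 3) {h : Fin n}
    (h5 : env 5 = h) :
    ((T (env 4) = none ∨ ∃ q, T (env 4) = some q ∧ h ∈ q) →
      (body A sigE costE).exec n env mem = mem) ∧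
    ∀ q, T (env 4) = some q → h ∉ q →
      Represents a mem₀ ((body A sigE costE).exec n env mem) (enter sig cost T (q ++ [h])) := by
  constructor
  · intro hq
    simp only [body, Cmd.exec, extended, newValue, eval_letE, eval_ite]
    rw [if_neg]
    · simp only [eval_load, eval_var, update_self]
      exact update_eq_self _ _
    · rw [not_not, eval_mul, eval_mul, mul_eq_zero, mul_eq_zero]
      left
      rcases hq with hq | ⟨q, hq, hhq⟩
      · left
        simp [hA, hmem.2, hq]
      · right
        have hqn := (hT _ _ hq).1
        rw [eval_sub, eval_one, used, eval_letE, eval_letE, eval_memTake (by simp) (by simp)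
          (by simp) (l := q) (length_le_of_nodup hqn) (u := h) (by simp [hA, hmem.2, hq])
          (by simp [h5])]
        simp [List.take_of_length_le (length_le_of_nodup hqn), hhq]
  · intro q hq hhq
    have hqn := (hT _ _ hq).1
    have hqh := nodup_append_singleton.2 ⟨hqn, hhq⟩
    have hlen := length_le_of_nodup hqn
    have h6 : (load (A + var 4)).eval n env mem = code q + 1 := by simp [hA, hmem.2, hq]
    have h1 : (var 6 - 1 + (var 5 + 1) * powB (letE 1 (var 6 - 1) (Expr.length 1))).eval n
        (update env 6 (code q + 1)) mem = code (q ++ [h]) := by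
      rw [eval_add, eval_mul, eval_powB, eval_letE, eval_length (l := q) (by simp) hlen (by simp),
        min_eq_left hlen, code_append_singleton]
      simp [h5]
    simp only [body, Cmd.exec, extended, newValue, eval_letE, h6, h1]
    set env' := update (update env 6 (code q + 1)) 1 (code (q ++ [h])) with henv'
    have hs : sigE.eval n env' mem = sig (q ++ [h]) :=
      hsig _ _ _ hqh (by simp [henv']) (by simp [henv', h2]) (by simp [henv', h3]) hmem.1
    have haddr : (A + sigE).eval n env' mem = a + sig (q ++ [h]) := by rw [eval_add, hA, hs]
    have hload : (load (A + sigE)).eval n env' mem = mem (a + sig (q ++ [h])) := by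
      rw [eval_load, haddr]
    rw [hload, haddr, eval_ite]
    set r := mem (a + sig (q ++ [h])) with hr
    have hu : used.eval n (update env' 8 r) mem = 0 := by
      rw [used, eval_letE, eval_letE, eval_memTake (by simp) (by simp)
          (by simp) (l := q) (length_le_of_nodup hqn) (u := h) (by simp [henv'])
          (by simp [henv', h5])]
      simp [List.take_of_length_le hlen, hhq]
    have hc : costE.eval n (update env' 8 r) mem = cost (q ++ [h]) :=
      hcost _ _ _ hqh (by simp [henv']) (by simp [henv', h2]) (by simp [henv', h3]) hmem.1
    have hval : (Expr.min (var 1 + 1) (powB size)).eval n (update env' 8 r) mem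
        = code (q ++ [h]) + 1 := by
      have := code_lt_of_nodup hqh
      simp [henv']
      omega
    rw [hval, eval_mul, eval_mul, eval_sub, hu, eval_ite, eval_lt', eval_letE, hc]
    have hmem' := hmem.2 (sig (q ++ [h]))
    rw [← hr] at hmem'
    simp only [eval_var, eval_one, update_self, Nat.sub_zero, mul_one, eval_sub, henv',
      update_of_ne (show (6 : ℕ) ≠ 8 by simp), update_of_ne (show (6 : ℕ) ≠ 1 by simp)]
    have hcond : (code q + 1) * (if r ≠ 0 then if cost (q ++ [h]) < costE.eval n
          (update (update env' 8 r) 1 (r - 1)) mem then 1 else 0 else 1) ≠ 0 ↔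
        ¬ Covers sig cost T (q ++ [h]) := by
      rw [Covers]
      cases hTr : T (sig (q ++ [h])) with
      | none =>
        rw [hTr, Option.elim_none] at hmem'
        simp [hmem']
      | some l =>
        rw [hTr, Option.elim_some] at hmem'
        rw [hcost _ mem l (hT _ _ hTr).1 (by simp [hmem']) (by simp [henv', h2])
          (by simp [henv', h3]) hmem.1, if_pos (by omega)]
        simp
    rw [enter]
    by_cases hcov : Covers sig cost T (q ++ [h])
    · rw [if_pos hcov, if_neg fun hne => hcond.1 hne hcov, hr, update_eq_self]
      exact hmem
    · rw [if_neg hcov, if_pos (hcond.2 hcov)]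
      refine ⟨fun x hx => ?_, fun s => ?_⟩
      · rw [update_of_ne (by omega), hmem.1 x hx]
      · by_cases hs : s = sig (q ++ [h])
        · subst hs
          rw [update_self, update_self, Option.elim_some]
        · rw [update_of_ne (by omega), update_of_ne hs, hmem.2]

/-- The search ends with a table that holds, for every sequence without repetitions, a sequence of the
same signature that is not more expensive. -/
theorem exec_cmd (hdom : Dominance sig cost) (hA : ∀ env mem, A.eval n env mem = a)
    (hsig : Computes a env₀ mem₀ sigE sig) (hcost : Computes a env₀ mem₀ costE cost)
    (hM : ∀ l h, (l ++ [h]).Nodup → sig l < M.eval n env₀ (update mem₀ a 1))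
    (hmem₀ : ∀ s, mem₀ (a + s) = 0) :
    ∃ T, ValidTable sig T ∧ Represents a mem₀ ((cmd A M sigE costE).exec n env₀ mem₀) T ∧
      ∀ l, l.Nodup → Covers sig cost T l := by
  have hinner : ∀ s mem T, ValidTable sig T → Represents a mem₀ mem T → ∀ j ≤ n,
      ∃ T', ValidTable sig T' ∧ Represents a mem₀ (iterMem (fun i m =>
          (body A sigE costE).exec n (update (update env₀ 4 s) 5 i) m) j mem) T' ∧
        (∀ l, Covers sig cost T l → Covers sig cost T' l) ∧ T' s = T s ∧
        ∀ q (h : Fin n), T s = some q → h ∉ q → h.val < j → Covers sig cost T' (q ++ [h]) := by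
    intro s mem T hT hmem j
    induction j with
    | zero => exact fun _ => ⟨T, hT, hmem, fun _ h => h, rfl, fun _ _ _ _ h => by omega⟩
    | succ j ih =>
      intro hj
      obtain ⟨T', hT', hmem', hcov, hTs, hnew⟩ := ih (by omega)
      have hbody := exec_body hA hsig hcost hT' hmem' (env := update (update env₀ 4 s) 5 j)
        (by simp) (by simp) (h := ⟨j, hj⟩) (by simp)
      rw [update_of_ne (by simp), update_self, hTs] at hbody
      by_cases hcase : T s = none ∨ ∃ q, T s = some q ∧ ⟨j, hj⟩ ∈ q
      · refine ⟨T', hT', ?_, hcov, hTs, fun q h hq hhq hlt => ?_⟩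
        · rw [iterMem, hbody.1 hcase]
          exact hmem'
        · refine hnew q h hq hhq (lt_of_le_of_ne (by omega) fun heq => ?_)
          obtain rfl : h = ⟨j, hj⟩ := Fin.ext heq
          rcases hcase with h0 | ⟨q', hq', hh⟩
          · simp [h0] at hq
          · rw [hq', Option.some_inj] at hq
            exact hhq (hq ▸ hh)
      · push Not at hcase
        obtain ⟨q, hq⟩ := Option.ne_none_iff_exists'.1 hcase.1
        have hjq := hcase.2 q hq
        obtain ⟨hqn, hqs⟩ := hT s q hq
        have hnodup := nodup_append_singleton.2 ⟨hqn, hjq⟩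
        have hlt := hdom.sig_lt _ _ hnodup
        refine ⟨enter sig cost T' (q ++ [(⟨j, hj⟩ : Fin n)]), hT'.enter hnodup, hbody.2 q hq hjq,
          fun l hl => (hcov l hl).enter _, ?_, fun q' h hq' hhq hlt => ?_⟩
        · rw [enter_of_ne (by omega), hTs]
        · rw [hq, Option.some_inj] at hq'
          subst hq'
          by_cases heq : h = ⟨j, hj⟩
          · rw [heq]
            exact covers_enter_self _
          · refine (hnew q h hq hhq (lt_of_le_of_ne (by omega) fun hc => heq (Fin.ext hc))).enter _
  have houter : ∀ N, ∃ T, ValidTable sig T ∧ Represents a mem₀ (iterMem (fun s m =>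
        (Cmd.loop 5 size (body A sigE costE)).exec n (update env₀ 4 s) m) N (update mem₀ a 1)) T ∧
      ∀ l, l.Nodup → (∀ q h, l = q ++ [h] → sig q < N) → Covers sig cost T l := by
    intro N
    induction N with
    | zero =>
      refine ⟨update (fun _ => none) 0 (some []), ?_, ⟨fun x hx => ?_, fun s => ?_⟩, ?_⟩
      · intro s l h
        by_cases hs : s = 0
        · subst hs
          rw [update_self, Option.some_inj] at h
          exact h ▸ ⟨List.nodup_nil, hdom.sig_nil⟩
        · simp [hs] at h
      · exact update_of_ne hx.ne _ _
      · by_cases hs : s = 0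
        · subst hs
          simp [iterMem, code]
        · simp [iterMem, hs, hmem₀]
      · intro l hl h
        obtain rfl | ⟨q, b, rfl⟩ := List.eq_nil_or_concat' l
        · exact ⟨[], by rw [hdom.sig_nil, update_self], le_rfl⟩
        · exact absurd (h q b rfl) (Nat.not_lt_zero _)
    | succ N ih =>
      obtain ⟨T, hT, hmem, hcov⟩ := ih
      obtain ⟨T', hT', hmem', hcov', -, hnew⟩ := hinner N _ T hT hmem n le_rfl
      refine ⟨T', hT', hmem', fun l hl h => ?_⟩
      by_cases hlt : ∀ q h, l = q ++ [h] → sig q < N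
      · exact hcov' l (hcov l hl hlt)
      · push Not at hlt
        obtain ⟨q, b, rfl, hq⟩ := hlt
        obtain ⟨hqn, hbq⟩ := nodup_append_singleton.1 hl
        have hqN : sig q = N := by have := h q b rfl; omega
        -- the prefix `q` is covered already, by the sequence in the cell under consideration
        obtain ⟨q₀, hq₀, hle⟩ := hcov q hqn (by
          rintro q' b' rfl
          have := hdom.sig_lt q' b' hqn
          omega)
        obtain ⟨hqn₀, hqs₀⟩ := hT _ _ hq₀
        obtain ⟨h1, h2, h3⟩ := hdom.extend q₀ q b hqn₀ hl hqs₀ hle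
        obtain ⟨l', hl', hcl'⟩ :=
          hnew q₀ b (hqN ▸ hq₀) (nodup_append_singleton.1 h1).2 b.2
        exact ⟨l', h2 ▸ hl', hcl'.trans h3⟩
  obtain ⟨T, hT, hmem, hcov⟩ := houter (M.eval n env₀ (update mem₀ a 1))
  refine ⟨T, hT, ?_, fun l hl => hcov l hl fun q h hq => ?_⟩
  · simp only [cmd, Cmd.exec, hA, eval_one]
    exact hmem
  · subst hq
    exact hM q h hl

/-! ### The time of the search, and the size of its values -/

/-- The time of `cmd` that does not depend on the number of signatures. -/
def baseTime (A M : Expr) (n : ℕ) : ℕ := A.time n + M.time n + 5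

/-- The time that `cmd` spends on one signature. -/
def cellTime (A sig cost : Expr) (n : ℕ) : ℕ :=
  n * ((extended A (A + sig)).time n + (extended A (newValue A sig cost)).time n + 5) + 9

theorem time_cmd (A M sigE costE : Expr) (env mem : ℕ → ℕ) :
    (cmd A M sigE costE).time n env mem = baseTime A M n +
      M.eval n env (update mem (A.eval n env mem) 1) * cellTime A sigE costE n := by
  have h1 : (1 : Expr).time n = 1 := rfl
  have h2 : Expr.size.time n = 2 := rfl
  simp only [cmd, Cmd.time, body, Cmd.exec, h1, h2, Finset.sum_const, Finset.card_range,
    smul_eq_mul, eval_size, eval_one, baseTime, cellTime]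
  ring

theorem polyBounded_baseTime (A M : Expr) : PolyBounded fun n _ => baseTime A M n :=
  (A.polyBounded_time.add M.polyBounded_time).add (.const 5)

theorem polyBounded_cellTime (A sigE costE : Expr) :
    PolyBounded fun n _ => cellTime A sigE costE n :=
  (PolyBounded.fst.mul (((extended A (A + sigE)).polyBounded_time.add
    (extended A (newValue A sigE costE)).polyBounded_time).add (.const 5))).add (.const 9)

theorem safe_loop {L x : ℕ} {b : Expr} {c : Cmd} {env mem : ℕ → ℕ}
    (hb : b.eval n env mem < 2 ^ L) (hmem : ∀ y, mem y < 2 ^ L)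
    (hc : ∀ j mem, (∀ y, mem y < 2 ^ L) → c.Safe n L (update env x j) mem) :
    (Cmd.loop x b c).Safe n L env mem := by
  have key : ∀ j y, iterMem (fun i m => c.exec n (update env x i) m) j mem y < 2 ^ L := by
    intro j
    induction j with
    | zero => exact hmem
    | succ j ih => exact c.exec_lt (hc j _ ih) ih
  exact ⟨hb, fun j _ => hc j _ (key j)⟩

/-- The search writes only `1`, numbers that it finds in the memory, and, because of the minimum in
`newValue`, numbers of size at most `(n + 1) ^ n`. -/
theorem safe_cmd {L : ℕ} {env mem : ℕ → ℕ} (hn : (n + 1) ^ n < 2 ^ L) (hn' : n < 2 ^ L)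
    (hM : M.eval n env (update mem (A.eval n env mem) 1) < 2 ^ L) (hmem : ∀ y, mem y < 2 ^ L) :
    (cmd A M sigE costE).Safe n L env mem := by
  have hpos : 1 < 2 ^ L := lt_of_le_of_lt (Nat.one_le_pow _ _ (by omega)) hn
  refine ⟨hpos, safe_loop hM (update_lt hmem _ hpos) fun s m hm =>
    safe_loop hn' hm fun j m' hm' => ?_⟩
  simp only [body, Cmd.Safe, extended, newValue, eval_letE, eval_ite]
  split_ifs
  · refine lt_of_le_of_lt ?_ hn
    rw [eval_min, eval_powB, eval_size, min_self]
    exact min_le_right _ _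
  · exact hm' _

end Search

/-! ### The masks of sequences -/

section Mask

variable {n : ℕ}

/-- The set of elements of a sequence as a binary number. -/
def mask (l : List (Fin n)) : ℕ := (l.map fun h => 2 ^ h.val).sum

theorem mask_append_singleton (l : List (Fin n)) (h : Fin n) :
    mask (l ++ [h]) = mask l + 2 ^ h.val := by
  simp [mask]

theorem mask_eq_sum {l : List (Fin n)} (hl : l.Nodup) :
    mask l = ∑ k ∈ l.toFinset.map Fin.valEmbedding, 2 ^ k := by
  rw [Finset.sum_map, List.sum_toFinset _ hl, mask]
  rfl

theorem toFinset_eq_of_mask_eq {l l' : List (Fin n)} (hl : l.Nodup) (hl' : l'.Nodup)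
    (h : mask l = mask l') : l.toFinset = l'.toFinset := by
  rw [mask_eq_sum hl, mask_eq_sum hl'] at h
  exact Finset.map_injective _ (Finset.geomSum_injective le_rfl h)

theorem mask_lt {l : List (Fin n)} (hl : l.Nodup) : mask l < 2 ^ n := by
  rw [mask_eq_sum hl]
  refine Nat.geomSum_lt le_rfl fun k hk => ?_
  obtain ⟨a, -, rfl⟩ := Finset.mem_map.1 hk
  exact a.2

theorem mask_full {l : List (Fin n)} (hl : l.Nodup) (hfull : ∀ v, v ∈ l) :
    mask l = ∑ k ∈ Finset.range n, 2 ^ k := by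
  rw [Finset.sum_range, mask, ← List.sum_toFinset _ hl]
  exact Finset.sum_congr (Finset.ext fun v => by simp [hfull]) fun _ _ => rfl

theorem length_eq_of_toFinset_eq {l l' : List (Fin n)} (hl : l.Nodup) (hl' : l'.Nodup)
    (h : l.toFinset = l'.toFinset) : l.length = l'.length := by
  rw [← List.toFinset_card_of_nodup hl, h, List.toFinset_card_of_nodup hl']

end Mask

/-! ### Boundaries and the choice of the vertex order -/

section Boundary

variable {n : ℕ} (G : SimpleGraph (Fin n))

open Classical in
/-- The vertices of `S` with a neighbour outside of `S`. -/
noncomputable def boundary (S : Finset (Fin n)) : Finset (Fin n) :=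
  S.filter fun v => ∃ u, u ∉ S ∧ G.Adj v u

theorem mem_boundary {S : Finset (Fin n)} {v : Fin n} :
    v ∈ boundary G S ↔ v ∈ S ∧ ∃ u, u ∉ S ∧ G.Adj v u := by
  simp [boundary]

@[simp]
theorem boundary_empty : boundary G ∅ = ∅ := by
  ext
  simp [mem_boundary]

/-- The sum of the powers `(n + 1) ^ b` over the sizes `b` of the boundaries of the nonempty
initial segments. It bounds each of these powers, and it depends on the last initial segment only
through its set of elements, as dominance requires. -/
noncomputable def widthCost (l : List (Fin n)) : ℕ :=
  ∑ i ∈ Finset.range l.length, (n + 1) ^ (boundary G (l.take (i + 1)).toFinset).card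

theorem widthCost_append_singleton (l : List (Fin n)) (h : Fin n) :
    widthCost G (l ++ [h]) =
      widthCost G l + (n + 1) ^ (boundary G (insert h l.toFinset)).card := by
  rw [widthCost, List.length_append, List.length_singleton, Finset.sum_range_succ, widthCost]
  congr 1
  · refine Finset.sum_congr rfl fun i hi => ?_
    rw [List.take_append_of_le_length (by simpa using hi)]
  · rw [List.take_of_length_le (by simp)]
    congr 3
    ext x
    simp

theorem dominance_widthCost : Dominance mask (widthCost G) where
  sig_nil := rfl
  sig_lt l h _ := by simp [mask_append_singleton]
  extend l l' h hl hl' hs hc := by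
    obtain ⟨hl'n, hh⟩ := nodup_append_singleton.1 hl'
    have hset := toFinset_eq_of_mask_eq hl hl'n hs
    refine ⟨nodup_append_singleton.2 ⟨hl, ?_⟩, ?_, ?_⟩
    · rwa [← List.mem_toFinset, hset, List.mem_toFinset]
    · rw [mask_append_singleton, mask_append_singleton, hs]
    · rw [widthCost_append_singleton, widthCost_append_singleton, hset]
      omega

theorem pow_card_boundary_le {l : List (Fin n)} (m : ℕ) (hm : m ≤ l.length) :
    (n + 1) ^ (boundary G (l.take m).toFinset).card ≤ widthCost G l + 1 := by
  cases m with
  | zero =>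
    simp
  | succ m =>
    refine le_trans ?_ (Nat.le_succ _)
    exact Finset.single_le_sum (f := fun i =>
      (n + 1) ^ (boundary G (l.take (i + 1)).toFinset).card) (fun _ _ => Nat.zero_le _)
      (Finset.mem_range.2 hm)

theorem widthCost_le {l : List (Fin n)} (hl : l.length ≤ n) {w : ℕ}
    (h : ∀ i, (boundary G (l.take i).toFinset).card ≤ w) :
    widthCost G l ≤ n * (n + 1) ^ w := by
  refine (Finset.sum_le_card_nsmul _ _ ((n + 1) ^ w) fun i _ =>
    Nat.pow_le_pow_right (by omega) (h _)).trans ?_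
  rw [Finset.card_range, smul_eq_mul]
  exact Nat.mul_le_mul_right _ hl

end Boundary

/-! ### The allocation of houses along a vertex order -/

section Pack

variable {n : ℕ}

/-- The values of `f` on `S`, as the digits of a number in base `n + 1`. -/
def pack (S : Finset (Fin n)) (f : Fin n → ℕ) : ℕ :=
  ∑ v ∈ S, f v * (n + 1) ^ (S.filter (· < v)).card

theorem pack_insert {S : Finset (Fin n)} {a : Fin n} (ha : ∀ x ∈ S, x < a) (f : Fin n → ℕ) :
    pack (insert a S) f = pack S f + f a * (n + 1) ^ S.card := by
  have haS : a ∉ S := fun h => lt_irrefl _ (ha a h)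
  rw [pack, Finset.sum_insert haS, add_comm, pack]
  congr 1
  · refine Finset.sum_congr rfl fun v hv => ?_
    rw [Finset.filter_insert, if_neg (not_lt.2 (ha v hv).le)]
  · rw [Finset.filter_insert, if_neg (lt_irrefl a), Finset.filter_true_of_mem ha]

theorem pack_lt (S : Finset (Fin n)) {f : Fin n → ℕ} (hf : ∀ v, f v < n + 1) :
    pack S f < (n + 1) ^ S.card := by
  induction S using Finset.induction_on_max with
  | empty => simp [pack]
  | insert a S ha ih =>
    rw [pack_insert ha, Finset.card_insert_of_notMem fun h => lt_irrefl _ (ha a h), pow_succ]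
    have := hf a
    nlinarith

theorem pack_injective (S : Finset (Fin n)) {f g : Fin n → ℕ} (hf : ∀ v, f v < n + 1)
    (hg : ∀ v, g v < n + 1) (h : pack S f = pack S g) : ∀ v ∈ S, f v = g v := by
  induction S using Finset.induction_on_max with
  | empty => simp
  | insert a S ha ih =>
    rw [pack_insert ha, pack_insert ha] at h
    have hpos : 0 < (n + 1) ^ S.card := by positivity
    have hdiv := congrArg (· / (n + 1) ^ S.card) h
    have hmod := congrArg (· % (n + 1) ^ S.card) h
    simp only [Nat.add_mul_div_right _ _ hpos, Nat.add_mul_mod_self_right,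
      Nat.div_eq_of_lt (pack_lt S hf), Nat.div_eq_of_lt (pack_lt S hg), zero_add,
      Nat.mod_eq_of_lt (pack_lt S hf), Nat.mod_eq_of_lt (pack_lt S hg)] at hdiv hmod
    intro v hv
    rcases Finset.mem_insert.1 hv with rfl | hv
    · exact hdiv
    · exact ih hmod v hv

theorem pack_congr {S : Finset (Fin n)} {f g : Fin n → ℕ} (h : ∀ v ∈ S, f v = g v) :
    pack S f = pack S g :=
  Finset.sum_congr rfl fun v hv => by rw [h v hv]

end Pack

section Alloc

variable {n : ℕ} (G : SimpleGraph (Fin n)) (O : List (Fin n)) (W : ℕ)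
  (cost : Fin n → Fin n → ℕ → ℕ → ℕ)

/-- The sequence `l` of houses assigns the house `l[j]` to the agent `O[j]`. The house of agent
`v` is encoded by its number plus one; the agents at the end of `O` that have no house yet are
given the value `0`. -/
def houseOf (l : List (Fin n)) (v : Fin n) : ℕ := digitAt l (O.idxOf v)

/-- The set of the houses in use, together with the houses of the agents on the boundary, which are
encoded by a number less than `W`. -/
noncomputable def allocSig (l : List (Fin n)) : ℕ :=
  mask l * W + pack (boundary G (O.take l.length).toFinset) (houseOf O l)

open Classical in
/-- The contribution of `u < v` to the cost of a partial allocation, where `cost u v` is the cost of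
an edge depending on the houses of its ends. -/
noncomputable def pairCost (l : List (Fin n)) (u v : Fin n) : ℕ :=
  if (u < v ∧ G.Adj u v) ∧ 0 < houseOf O l u ∧ 0 < houseOf O l v then
    cost u v (houseOf O l u - 1) (houseOf O l v - 1) else 0

/-- The cost of a partial allocation. -/
noncomputable def allocCost (l : List (Fin n)) : ℕ :=
  ∑ u, ∑ v, pairCost G O cost l u v

theorem houseOf_lt (l : List (Fin n)) (v : Fin n) : houseOf O l v < n + 1 := by
  rw [houseOf, digitAt]
  cases l[O.idxOf v]? with
  | none => simp
  | some a => simp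

variable {O W}

theorem houseOf_pos (hfull : ∀ v, v ∈ O) {l : List (Fin n)} {v : Fin n} :
    0 < houseOf O l v ↔ v ∈ O.take l.length := by
  rw [houseOf, digitAt_pos, List.mem_take_iff_idxOf_lt (hfull v)]

theorem length_of_full (hO : O.Nodup) (hfull : ∀ v, v ∈ O) : O.length = n := by
  rw [← List.toFinset_card_of_nodup hO, show O.toFinset = Finset.univ by ext; simp [hfull]]
  simp

theorem houseOf_append_singleton (hfull : ∀ v, v ∈ O) {l : List (Fin n)} {v₀ : Fin n}
    (hv₀ : O.idxOf v₀ = l.length) (h v : Fin n) :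
    houseOf O (l ++ [h]) v = if v = v₀ then h.val + 1 else houseOf O l v := by
  split_ifs with hv
  · rw [hv, houseOf, hv₀, digitAt]
    simp
  · have hne : O.idxOf v ≠ l.length := fun heq =>
      hv ((List.idxOf_inj (hfull v)).1 (heq.trans hv₀.symm))
    rw [houseOf, houseOf, digitAt, digitAt]
    rcases lt_or_gt_of_ne hne with hlt | hgt
    · rw [List.getElem?_append_left hlt]
    · rw [List.getElem?_eq_none (by simp; omega), List.getElem?_eq_none (by omega)]

theorem allocSig_lt (hW : ∀ m ≤ n, (n + 1) ^ (boundary G (O.take m).toFinset).card ≤ W)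
    {l : List (Fin n)} (hl : l.length ≤ n) : allocSig G O W l < (mask l + 1) * W := by
  have h1 := pack_lt (boundary G (O.take l.length).toFinset) (houseOf_lt O l)
  have h2 := hW _ hl
  rw [allocSig, add_mul]
  omega

theorem dominance_allocCost (hO : O.Nodup) (hfull : ∀ v, v ∈ O)
    (hW : ∀ m ≤ n, (n + 1) ^ (boundary G (O.take m).toFinset).card ≤ W) :
    Dominance (allocSig G O W) (allocCost G O cost) where
  sig_nil := by simp [allocSig, mask, pack]
  sig_lt l h hl := by
    have hln := length_le_of_nodup (nodup_append_singleton.1 hl).1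
    refine (allocSig_lt G hW hln).trans_le ?_
    rw [allocSig, mask_append_singleton]
    exact (Nat.mul_le_mul_right _ (by have := Nat.one_le_two_pow (n := h.val); omega)).trans
      (Nat.le_add_right _ _)
  extend l l' h hl hl' hs hc := by
    obtain ⟨hl'n, hh⟩ := nodup_append_singleton.1 hl'
    have hmask : mask l = mask l' := by
      have h1 := allocSig_lt G hW (length_le_of_nodup hl)
      have h2 := allocSig_lt G hW (length_le_of_nodup hl'n)
      have h3 : mask l * W ≤ allocSig G O W l := Nat.le_add_right _ _
      have h4 : mask l' * W ≤ allocSig G O W l' := Nat.le_add_right _ _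
      rw [hs] at h1 h3
      have h5 := Nat.lt_of_mul_lt_mul_right (h3.trans_lt h2)
      have h6 := Nat.lt_of_mul_lt_mul_right (h4.trans_lt h1)
      omega
    have hset := toFinset_eq_of_mask_eq hl hl'n hmask
    have hlen := length_eq_of_toFinset_eq hl hl'n hset
    have hpack := hs
    rw [allocSig, allocSig, hmask, hlen, Nat.add_left_cancel_iff] at hpack
    have hbd := pack_injective _ (houseOf_lt O l) (houseOf_lt O l') hpack
    have hlt : l'.length < O.length := by
      rw [length_of_full hO hfull]
      have := length_le_of_nodup hl'
      simp at this
      omega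
    -- the agent that receives the house `h`
    set v₀ := O[l'.length] with hv₀
    have hidx : O.idxOf v₀ = l'.length := hO.idxOf_getElem _ hlt
    have hv₀take : v₀ ∉ O.take l'.length := by
      rw [List.mem_take_iff_idxOf_lt (hfull _), hidx]
      exact lt_irrefl _
    have hH := houseOf_append_singleton hfull (l := l) (hidx.trans hlen.symm) h
    have hH' := houseOf_append_singleton hfull hidx h
    have hzero : houseOf O l v₀ = 0 ∧ houseOf O l' v₀ = 0 := by
      constructor
      · rw [← not_ne_iff, ← Nat.pos_iff_ne_zero, houseOf_pos hfull, hlen]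
        exact hv₀take
      · rw [← not_ne_iff, ← Nat.pos_iff_ne_zero, houseOf_pos hfull]
        exact hv₀take
    -- a neighbour of the new agent has no house in either allocation, or it is on the boundary
    have hnbr : ∀ v, G.Adj v v₀ → houseOf O l v = houseOf O l' v := by
      intro v hv
      by_cases hvt : v ∈ O.take l'.length
      · exact hbd v ((mem_boundary G).2 ⟨by simpa using hvt, v₀, by simpa using hv₀take, hv⟩)
      · rw [← houseOf_pos hfull] at hvt
        have hvt' : ¬ 0 < houseOf O l v := by
          rw [houseOf_pos hfull, hlen, ← houseOf_pos hfull]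
          exact hvt
        omega
    refine ⟨nodup_append_singleton.2 ⟨hl, ?_⟩, ?_, ?_⟩
    · rwa [← List.mem_toFinset, hset, List.mem_toFinset]
    · rw [allocSig, allocSig, mask_append_singleton, mask_append_singleton, hmask,
        List.length_append, List.length_append, hlen]
      congr 1
      refine pack_congr fun v hv => ?_
      rw [hH, hH']
      split_ifs with hvv
      · rfl
      · obtain ⟨hv1, u, hu, hvu⟩ := (mem_boundary G).1 hv
        rw [List.mem_toFinset, List.mem_take_iff_idxOf_lt (hfull _), List.length_singleton] at hv1 hu
        refine hbd v ((mem_boundary G).2 ⟨?_, u, ?_, hvu⟩)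
        · rw [List.mem_toFinset, List.mem_take_iff_idxOf_lt (hfull _)]
          have : O.idxOf v ≠ l'.length := fun heq =>
            hvv ((List.idxOf_inj (hfull v)).1 (heq.trans hidx.symm))
          omega
        · rw [List.mem_toFinset, List.mem_take_iff_idxOf_lt (hfull _)]
          omega
    · -- the last step adds the same amount to the costs of both allocations
      have key : allocCost G O cost (l ++ [h]) + allocCost G O cost l' =
          allocCost G O cost (l' ++ [h]) + allocCost G O cost l := by
        simp only [allocCost, ← Finset.sum_add_distrib]
        refine Finset.sum_congr rfl fun u _ => Finset.sum_congr rfl fun v _ => ?_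
        by_cases hadj : u < v ∧ G.Adj u v
        · simp only [pairCost, hadj, hH, hH']
          by_cases hu : u = v₀
          · subst hu
            have hvne : v ≠ v₀ := hadj.2.ne'
            simp [hvne, hzero, hnbr v hadj.2.symm]
          · by_cases hv : v = v₀
            · subst hv
              simp [hu, hzero, hnbr u hadj.2]
            · simp only [hu, hv, if_false]
              exact add_comm _ _
        · simp [pairCost, hadj]
      omega

end Alloc

/-! ### Expressions for signatures and costs -/

/-- The memory holds a description of the graph: the adjacency matrix from address `1` on. -/
def HoldsGraph {n : ℕ} (G : SimpleGraph (Fin n)) (mem : ℕ → ℕ) : Prop :=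
  ∀ u v : Fin n, (G.Adj u v → mem (1 + u * n + v) = 1) ∧ (¬ G.Adj u v → mem (1 + u * n + v) = 0)

namespace Expr

/-- The mask of the sequence whose code is variable `1`. -/
def mask : Expr :=
  sum 22 (ite (digit (var 1) (var 22)) (pow (const 2) (digit (var 1) (var 22) - 1)) 0)

/-- The adjacency of the agents `var v` and `var u`. -/
def adj (v u : ℕ) : Expr := load (1 + var v * size + var u)

/-- Whether `var v` belongs to the boundary of the first `var m` elements of the sequence with code
`var c`. -/
def boundary (c m v : ℕ) : Expr :=
  memTake c m v * lt 0 (sum 23 ((1 - memTake c m 23) * adj v 23))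

/-- See `MEGHA.widthCost`. -/
def widthCost : Expr :=
  sum 24 (lt (var 24) (length 1) * letE 25 (var 24 + 1) (powB (sum 26 (boundary 1 25 26))))

/-- See `MEGHA.houseOf`; the vertex order has the code `var 2`. -/
def houseOf (v : ℕ) : Expr :=
  sum 27 (eq (digit (var 2) (var 27)) (var v + 1) * digit (var 1) (var 27))

/-- See `MEGHA.allocSig`; the vertex order has the code `var 2`, and `W` is `var 3`. -/
def allocSig : Expr :=
  mask * var 3 + letE 28 (length 1)
    (sum 29 (boundary 2 28 29 * (houseOf 29 *
      powB (sum 30 (lt (var 30) (var 29) * boundary 2 28 30)))))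

/-- See `MEGHA.allocCost`; here `edge` is the cost of the edge between the agents `var 31` and
`var 32` with the houses `var 35` and `var 36`. -/
def allocCost (edge : Expr) : Expr :=
  sum 31 (sum 32 (lt (var 31) (var 32) * adj 31 32 *
    letE 33 (houseOf 31) (letE 34 (houseOf 32) (lt 0 (var 33) * lt 0 (var 34) *
      letE 35 (var 33 - 1) (letE 36 (var 34 - 1) edge)))))

variable {n : ℕ} {env mem : ℕ → ℕ} {l O : List (Fin n)} {G : SimpleGraph (Fin n)}

theorem eval_mask (hl : l.Nodup) (h : env 1 = code l) : mask.eval n env mem = MEGHA.mask l := by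
  have hlen := length_le_of_nodup hl
  rw [mask, eval_sum, MEGHA.mask]
  have := sum_digitAt (fun x => if x ≠ 0 then 2 ^ Min.min (x - 1) n else 0) (by simp) hlen
  refine Eq.trans (Finset.sum_congr rfl fun j hj => ?_) (this.trans ?_)
  · rw [eval_ite, eval_pow_const, eval_sub, eval_digit_code (l := l) (by simp [h])
      (by simpa using hj)]
    simp
  · congr 1
    refine List.map_congr_left fun a _ => ?_
    rw [if_pos (by omega), Nat.add_sub_cancel, min_eq_left a.2.le]

open Classical in
theorem eval_adj (hG : HoldsGraph G mem) {v u : ℕ} {a b : Fin n} (hv : env v = a) (hu : env u = b) :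
    (adj v u).eval n env mem = if G.Adj a b then 1 else 0 := by
  simp only [adj, eval_load, eval_add, eval_mul, eval_one, eval_var, eval_size, hv, hu]
  split_ifs with h
  · exact (hG a b).1 h
  · exact (hG a b).2 h

theorem eval_boundary (hG : HoldsGraph G mem) {c m v : ℕ} (hc : c < 20) (hm : m ≠ 20 ∧ m ≠ 23)
    (hv : v ≠ 20 ∧ v ≠ 23) (hl : l.length ≤ n) (h : env c = code l) {a : Fin n} (ha : env v = a) :
    (boundary c m v).eval n env mem =
      if a ∈ MEGHA.boundary G (l.take (env m)).toFinset then 1 else 0 := by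
  rw [boundary, eval_mul, eval_memTake (by omega) hm.1 hv.1 hl h ha, eval_lt', eval_zero, eval_sum,
    Finset.sum_range]
  have : ∀ b : Fin n, ((1 - memTake c m 23) * adj v 23).eval n (update env 23 b) mem ≠ 0 ↔
      b ∉ l.take (env m) ∧ G.Adj a b := by
    intro b
    rw [eval_mul, eval_sub, eval_memTake (u := b) (by omega) hm.1 (by omega) hl
      (by rw [update_of_ne (by omega), h]) (by simp), eval_adj (a := a) (b := b) hG
      (by rw [update_of_ne hv.2, ha]) (by simp), update_of_ne hm.2]
    by_cases h1 : b ∈ l.take (env m) <;> by_cases h2 : G.Adj a b <;> simp [h1, h2]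
  have hpos : 0 < ∑ b : Fin n, ((1 - memTake c m 23) * adj v 23).eval n (update env 23 b) mem ↔
      ∃ b, b ∉ l.take (env m) ∧ G.Adj a b := by
    rw [Finset.sum_pos_iff]
    exact exists_congr fun b => by rw [Nat.pos_iff_ne_zero, this b]; simp
  by_cases h1 : a ∈ l.take (env m) <;>
    by_cases h2 : ∃ b, b ∉ l.take (env m) ∧ G.Adj a b <;>
    simp only [mem_boundary, List.mem_toFinset, h1, h2, hpos, if_true, if_false, and_self,
      and_false, false_and, mul_zero, mul_one]

/-- The sum of the indicator function of the boundary, weighted by `f`. -/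
theorem sum_boundary (S : Finset (Fin n)) (f : Fin n → ℕ) :
    ∑ a : Fin n, (if a ∈ S then 1 else 0) * f a = ∑ a ∈ S, f a := by
  simp [Finset.sum_ite_mem]

theorem eval_widthCost (hG : HoldsGraph G mem) (hl : l.Nodup) (h : env 1 = code l) :
    widthCost.eval n env mem = MEGHA.widthCost G l := by
  have hlen := length_le_of_nodup hl
  rw [widthCost, eval_sum, MEGHA.widthCost]
  have hsub : Finset.range l.length ⊆ Finset.range n := Finset.range_subset_range.2 hlen
  rw [← Finset.sum_subset hsub (f := fun i => eval n _ (update env 24 i) mem)]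
  · refine Finset.sum_congr rfl fun i hi => ?_
    rw [eval_mul, eval_lt', eval_length (l := l) (by simp) hlen (by simp [h]), eval_letE, eval_powB,
      eval_sum, Finset.sum_range, if_pos (by simpa using hi), one_mul]
    have hb : ∀ a : Fin n, (boundary 1 25 26).eval n
        (update (update (update env 24 i) 25 ((var 24 + 1).eval n (update env 24 i) mem)) 26 a) mem =
        (if a ∈ MEGHA.boundary G (l.take (i + 1)).toFinset then 1 else 0) * 1 := by
      intro a
      rw [eval_boundary (l := l) (a := a) hG (by simp) (by simp) (by simp) hlen (by simp [h])
        (by simp)]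
      simp
    simp only [hb]
    rw [sum_boundary, ← Finset.card_eq_sum_ones, min_eq_left (card_finset_fin_le _)]
  · intro i _ hi
    rw [eval_mul, eval_lt', eval_length (l := l) (by simp) hlen (by simp [h]),
      if_neg (by simpa using hi), zero_mul]

theorem eval_houseOf (hO : O.Nodup) (hfull : ∀ v, v ∈ O) (h1 : env 1 = code l)
    (h2 : env 2 = code O) {v : ℕ} (hv : v ≠ 27) {a : Fin n} (ha : env v = a) :
    (houseOf v).eval n env mem = MEGHA.houseOf O l a := by
  have hlt : O.idxOf a < n := by
    exact (List.idxOf_lt_length_of_mem (hfull a)).trans_le (length_le_of_nodup hO)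
  rw [houseOf, eval_sum, MEGHA.houseOf, Finset.sum_eq_single (O.idxOf a)]
  · rw [eval_mul, eval_eq, eval_digit_code (l := O) (by simp [h2]) (by simpa using hlt),
      eval_digit_code (l := l) (by simp [h1]) (by simpa using hlt), if_pos]
    · simp
    · simp only [eval_var, update_self, eval_add, update_of_ne hv, ha, eval_one]
      exact digitAt_eq.2 (List.getElem?_idxOf (hfull a))
  · intro j hj hne
    rw [eval_mul, eval_eq, eval_digit_code (l := O) (by simp [h2]) (by simpa using hj), if_neg,
      zero_mul]
    simp only [eval_var, update_self, eval_add, update_of_ne hv, ha, eval_one]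
    intro hd
    obtain ⟨hj', hja⟩ := List.getElem?_eq_some_iff.1 (digitAt_eq.1 hd)
    exact hne (by rw [← hja, hO.idxOf_getElem])
  · intro hn
    exact absurd (Finset.mem_range.2 hlt) hn

theorem eval_allocSig (hG : HoldsGraph G mem) (hO : O.Nodup) (hfull : ∀ v, v ∈ O) (hl : l.Nodup)
    (h1 : env 1 = code l) (h2 : env 2 = code O) :
    allocSig.eval n env mem = MEGHA.allocSig G O (env 3) l := by
  have hlen := length_le_of_nodup hl
  have hlenO := length_le_of_nodup hO
  rw [allocSig, eval_add, eval_mul, eval_mask hl h1, MEGHA.allocSig, eval_var, eval_letE, eval_sum,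
    eval_length (by simp) hlen h1, Finset.sum_range, pack]
  refine congrArg _ (Eq.trans (Finset.sum_congr rfl fun a _ => ?_) (sum_boundary _ _))
  rw [eval_mul, eval_boundary (l := O) (a := a) hG (by simp) (by simp) (by simp) hlenO (by simp [h2])
    (by simp), eval_mul, eval_houseOf (l := l) hO hfull (a := a) (by simp [h1]) (by simp [h2]) (by simp)
    (by simp), eval_powB, eval_sum, Finset.sum_range]
  have hb : ∀ b : Fin n, (lt (var 30) (var 29) * boundary 2 28 30).eval n
      (update (update (update env 28 l.length) 29 a) 30 b) mem =
      (if b ∈ MEGHA.boundary G (O.take l.length).toFinset then 1 else 0) *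
        (if b < a then 1 else 0) := by
    intro b
    rw [eval_mul, eval_boundary (l := O) (a := b) hG (by simp) (by simp) (by simp) hlenO
      (by simp [h2]) (by simp)]
    simp [mul_comm]
  simp only [hb]
  rw [sum_boundary, ← Finset.card_filter, min_eq_left (card_finset_fin_le _)]
  simp

theorem eval_allocCost (hG : HoldsGraph G mem) (hO : O.Nodup) (hfull : ∀ v, v ∈ O)
    (h1 : env 1 = code l) (h2 : env 2 = code O) {edge : Expr}
    {cost : Fin n → Fin n → ℕ → ℕ → ℕ} (hedge : ∀ (env : ℕ → ℕ) (u v : Fin n), env 31 = u →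
      env 32 = v → env 35 < n → env 36 < n → edge.eval n env mem = cost u v (env 35) (env 36)) :
    (allocCost edge).eval n env mem = MEGHA.allocCost G O cost l := by
  rw [allocCost, eval_sum, MEGHA.allocCost, Finset.sum_range]
  refine Finset.sum_congr rfl fun u _ => ?_
  rw [eval_sum, Finset.sum_range]
  refine Finset.sum_congr rfl fun v _ => ?_
  rw [eval_mul, eval_mul, eval_adj (a := u) (b := v) hG (by simp) (by simp), eval_letE, eval_letE,
    eval_houseOf (l := l) hO hfull (a := u) (by simp [h1]) (by simp [h2]) (by simp) (by simp),
    eval_houseOf (l := l) hO hfull (a := v) (by simp [h1]) (by simp [h2]) (by simp) (by simp), pairCost]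
  have h31 := houseOf_lt O l u
  have h32 := houseOf_lt O l v
  by_cases hc : (u < v ∧ G.Adj u v) ∧ 0 < MEGHA.houseOf O l u ∧ 0 < MEGHA.houseOf O l v
  · rw [if_pos hc, eval_mul, eval_letE, eval_letE,
      hedge _ u v (by simp) (by simp) (by simp; omega) (by simp; omega)]
    simp [hc]
  · rw [if_neg hc, eval_mul]
    simp only [eval_lt', eval_mul, eval_var, eval_zero, update_self, ne_eq, Nat.reduceEqDiff,
      not_false_eq_true, update_of_ne, Fin.val_fin_lt]
    split_ifs <;> simp_all

end Expr

/-! ### Scaling the envy to natural numbers -/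

namespace Instance

variable {n : ℕ} (I : Instance n)

/-- The product of the denominators of all valuations, as a common denominator. -/
def commonDen : ℕ := ∏ v, ∏ h, (I.val v h).den

/-- The valuations, multiplied by the common denominator. -/
def scaledVal (v : Fin n) (h : ℕ) : ℕ :=
  if hn : h < n then (I.val v ⟨h, hn⟩).num * (I.commonDen / (I.val v ⟨h, hn⟩).den) else 0

/-- The envy between two agents, multiplied by the common denominator. Truncated subtraction takes
care of the maximum with `0`. -/
def scaledEnvy (v u : Fin n) (hv hu : ℕ) : ℕ :=
  (I.scaledVal v hu - I.scaledVal v hv) + (I.scaledVal u hv - I.scaledVal u hu)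

theorem commonDen_pos : 0 < I.commonDen :=
  Finset.prod_pos fun v _ => Finset.prod_pos fun h _ => (I.val v h).den_pos

theorem den_dvd_commonDen (v h : Fin n) : (I.val v h).den ∣ I.commonDen :=
  (Finset.dvd_prod_of_mem (fun h => (I.val v h).den) (Finset.mem_univ h)).trans
    (Finset.dvd_prod_of_mem (fun v => ∏ h, (I.val v h).den) (Finset.mem_univ v))

theorem scaledVal_cast (v h : Fin n) : (I.scaledVal v h : ℚ) = I.commonDen * (I.val v h : ℚ) := by
  obtain ⟨k, hk⟩ := I.den_dvd_commonDen v h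
  have hpos := (I.val v h).den_pos
  have hden : ((I.val v h).den : ℚ) ≠ 0 := by exact_mod_cast hpos.ne'
  rw [scaledVal, dif_pos h.2, Fin.eta, hk, Nat.mul_div_cancel_left _ hpos]
  have hval : (I.val v h : ℚ) * (I.val v h).den = (I.val v h).num := by
    exact_mod_cast NNRat.mul_den_eq_num (I.val v h)
  push_cast
  rw [← hval]
  ring

theorem scaledEnvy_cast (v u hv hu : Fin n) :
    (I.scaledEnvy v u hv hu : ℚ) = I.commonDen * I.edgeEnvy v u hv hu := by
  have key : ∀ a b : ℕ, ((a - b : ℕ) : ℚ) = max ((a : ℚ) - b) 0 := by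
    intro a b
    rcases le_total a b with h | h
    · have : (a : ℚ) ≤ b := by exact_mod_cast h
      rw [Nat.sub_eq_zero_of_le h, max_eq_right (by linarith), Nat.cast_zero]
    · have : (b : ℚ) ≤ a := by exact_mod_cast h
      rw [Nat.cast_sub h, max_eq_left (by linarith)]
  have hD : (0 : ℚ) ≤ I.commonDen := by positivity
  rw [scaledEnvy, Nat.cast_add, key, key, edgeEnvy, scaledVal_cast, scaledVal_cast, scaledVal_cast,
    scaledVal_cast, mul_add, mul_max_of_nonneg _ _ hD, mul_max_of_nonneg _ _ hD]
  simp only [mul_sub, mul_zero]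

theorem allocCost_cast {O l : List (Fin n)} {π : Fin n ≃ Fin n}
    (h : ∀ v, houseOf O l v = π v + 1) :
    (allocCost I.graph O I.scaledEnvy l : ℚ) = I.commonDen * I.totalEnvy π := by
  rw [allocCost, totalEnvy, Nat.cast_sum, Finset.mul_sum]
  refine Finset.sum_congr rfl fun u _ => ?_
  rw [Nat.cast_sum, Finset.mul_sum]
  refine Finset.sum_congr rfl fun v _ => ?_
  have hpos : ∀ v, 0 < houseOf O l v := fun v => by rw [h]; omega
  by_cases huv : u < v ∧ I.graph.Adj u v
  · rw [pairCost, if_pos ⟨huv, hpos u, hpos v⟩, if_pos huv, h, h]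
    exact I.scaledEnvy_cast u v _ _
  · rw [pairCost, if_neg fun hc => huv hc.1, if_neg huv, Nat.cast_zero, mul_zero]

theorem totalEnvy_le_of_allocCost_le {O l l' : List (Fin n)} {π π' : Fin n ≃ Fin n}
    (h : ∀ v, houseOf O l v = π v + 1) (h' : ∀ v, houseOf O l' v = π' v + 1)
    (hle : allocCost I.graph O I.scaledEnvy l ≤ allocCost I.graph O I.scaledEnvy l') :
    I.totalEnvy π ≤ I.totalEnvy π' := by
  have hD : (0 : ℚ) < I.commonDen := by exact_mod_cast I.commonDen_pos
  refine le_of_mul_le_mul_left ?_ hD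
  rw [← I.allocCost_cast h, ← I.allocCost_cast h']
  exact_mod_cast hle

end Instance

/-- The allocation that is given by a sequence of all houses. -/
theorem exists_equiv_houseOf {n : ℕ} {O l : List (Fin n)} (hO : O.Nodup) (hO' : ∀ v, v ∈ O)
    (hl : l.Nodup) (hl' : ∀ h, h ∈ l) :
    ∃ π : Fin n ≃ Fin n, ∀ v, houseOf O l v = π v + 1 := by
  have hlt : ∀ v, O.idxOf v < l.length := fun v => by
    rw [length_of_full hl hl']
    exact (List.idxOf_lt_length_of_mem (hO' v)).trans_le (length_le_of_nodup hO)
  have hinj : Injective fun v => l[O.idxOf v]'(hlt v) := fun u v huv =>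
    (List.idxOf_inj (hO' u)).1 ((hl.getElem_inj_iff).1 huv)
  refine ⟨Equiv.ofBijective _ (Finite.injective_iff_bijective.1 hinj), fun v => ?_⟩
  rw [houseOf, digitAt_eq]
  simp [hlt v]

theorem houseOf_map {n : ℕ} {O : List (Fin n)} (hO : ∀ v, v ∈ O) (π : Fin n ≃ Fin n) (v : Fin n) :
    houseOf O (O.map π) v = π v + 1 := by
  rw [houseOf, digitAt_eq, List.getElem?_map, List.getElem?_idxOf (hO v)]
  rfl

/-! ### The input -/

namespace Instance

variable {n : ℕ} (I : Instance n)

/-- The memory contains the graph and the valuations at the addresses specified by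
`Instance.encode`. -/
structure Holds (mem : ℕ → ℕ) : Prop where
  graph : HoldsGraph I.graph mem
  num : ∀ v h : Fin n, mem (1 + n * n + v * n + h) = (I.val v h).num
  den : ∀ v h : Fin n, mem (1 + 2 * (n * n) + v * n + h) = (I.val v h).den

theorem add_mul_lt (v h : Fin n) : (v : ℕ) * n + h < n * n := by
  have h1 : ((v : ℕ) + 1) * n ≤ n * n := Nat.mul_le_mul_right _ v.2
  have := h.2
  rw [add_mul] at h1
  omega

theorem Holds.congr {I : Instance n} {mem mem' : ℕ → ℕ} (h : I.Holds mem)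
    (hmem : ∀ x < 3 * (n * n) + 1, mem' x = mem x) : I.Holds mem' := by
  refine ⟨fun u v => ?_, fun u v => ?_, fun u v => ?_⟩
  · rw [hmem _ (by have := add_mul_lt u v; omega)]
    exact h.graph u v
  · rw [hmem _ (by have := add_mul_lt u v; omega)]
    exact h.num u v
  · rw [hmem _ (by have := add_mul_lt u v; omega)]
    exact h.den u v

theorem getElem?_ofFn_mul (f : Fin n → Fin n → ℕ) (v h : Fin n) :
    (List.ofFn fun i : Fin (n * n) => f i.divNat i.modNat)[(v : ℕ) * n + h]? = some (f v h) := by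
  have hlt := add_mul_lt v h
  have hn : 0 < n := v.pos
  rw [List.getElem?_ofFn, dif_pos hlt]
  congr 2
  · ext
    simp only [Fin.coe_divNat]
    rw [add_comm, Nat.add_mul_div_right _ _ hn, Nat.div_eq_of_lt h.2, zero_add]
  · ext
    simp only [Fin.coe_modNat]
    rw [add_comm, Nat.add_mul_mod_self_right, Nat.mod_eq_of_lt h.2]

theorem holds_encode : I.Holds fun a => I.encode.getD a 0 := by
  classical
  refine ⟨fun u v => ?_, fun u v => ?_, fun u v => ?_⟩ <;> have hlt := add_mul_lt u v
  · have : I.encode.getD (1 + u * n + v) 0 = if I.graph.Adj u v then 1 else 0 := by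
      rw [encode, List.getD_eq_getElem?_getD, show 1 + (u : ℕ) * n + v = (u * n + v) + 1 by ring,
        List.getElem?_cons_succ, List.append_assoc, List.getElem?_append_left (by simpa using hlt),
        getElem?_ofFn_mul fun u v => if I.graph.Adj u v then 1 else 0]
      rfl
    simp only [this]
    exact ⟨fun h => if_pos h, fun h => if_neg h⟩
  · rw [encode, List.getD_eq_getElem?_getD,
      show 1 + n * n + (u : ℕ) * n + v = (n * n + (u * n + v)) + 1 by ring,
      List.getElem?_cons_succ, List.append_assoc, List.getElem?_append_right (by simp),
      List.length_ofFn, Nat.add_sub_cancel_left, List.getElem?_append_left (by simpa using hlt),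
      getElem?_ofFn_mul fun v h => (I.val v h).num]
    rfl
  · rw [encode, List.getD_eq_getElem?_getD,
      show 1 + 2 * (n * n) + (u : ℕ) * n + v = (n * n + n * n + (u * n + v)) + 1 by ring,
      List.getElem?_cons_succ, List.getElem?_append_right (by simp),
      List.length_append, List.length_ofFn, List.length_ofFn, Nat.add_sub_cancel_left,
      getElem?_ofFn_mul fun v h => (I.val v h).den]
    rfl

theorem encode_getD_zero : I.encode.getD 0 0 = n := by
  rw [encode]
  rfl

theorem encode_getD_of_le {a : ℕ} (h : 3 * (n * n) + 1 ≤ a) : I.encode.getD a 0 = 0 := by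
  rw [List.getD_eq_default]
  simp [encode]
  omega

theorem encode_getD_lt {L : ℕ} (hn : n < 2 ^ L) (hL : 1 < 2 ^ L) (hb : I.bitLength ≤ L) (a : ℕ) :
    I.encode.getD a 0 < 2 ^ L := by
  have hval : ∀ v h, (I.val v h).num < 2 ^ L ∧ (I.val v h).den < 2 ^ L := by
    intro v h
    have h1 : (I.val v h).num.size + (I.val v h).den.size ≤ I.bitLength :=
      Finset.le_sup (f := fun p : Fin n × Fin n =>
        (I.val p.1 p.2).num.size + (I.val p.1 p.2).den.size) (Finset.mem_univ (v, h))
    exact ⟨Nat.size_le.1 (by omega), Nat.size_le.1 (by omega)⟩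
  have hmem : ∀ x ∈ I.encode, x < 2 ^ L := by
    intro x hx
    simp only [encode, List.mem_cons, List.mem_append, List.mem_ofFn] at hx
    rcases hx with rfl | (⟨i, rfl⟩ | ⟨i, rfl⟩) | ⟨i, rfl⟩
    · exact hn
    · split_ifs <;> omega
    · exact (hval _ _).1
    · exact (hval _ _).2
  rw [List.getD_eq_getElem?_getD]
  cases h : I.encode[a]? with
  | none => simp
  | some x => exact hmem x (List.mem_of_getElem? h)

end Instance

/-! ### The program -/

namespace Expr

/-- See `Instance.commonDen`. -/
def commonDen : Expr :=
  prod 38 (prod 39 (load (1 + (1 + 1) * (size * size) + var 38 * size + var 39)))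

/-- See `Instance.scaledVal`. -/
def scaledVal (v h : ℕ) : Expr :=
  load (1 + size * size + var v * size + var h) *
    (commonDen / load (1 + (1 + 1) * (size * size) + var v * size + var h))

/-- See `Instance.scaledEnvy`: the envy between the agents `var 31` and `var 32` with the houses
`var 35` and `var 36`. -/
def scaledEnvy : Expr :=
  (scaledVal 31 36 - scaledVal 31 35) + (scaledVal 32 35 - scaledVal 32 36)

variable {n : ℕ} {I : Instance n} {env mem : ℕ → ℕ}

theorem eval_commonDen (h : I.Holds mem) : commonDen.eval n env mem = I.commonDen := by
  rw [commonDen, eval_prod, Instance.commonDen, Finset.prod_range]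
  refine Finset.prod_congr rfl fun v _ => ?_
  rw [eval_prod, Finset.prod_range]
  refine Finset.prod_congr rfl fun x _ => ?_
  simp [h.den]

theorem eval_scaledVal (hI : I.Holds mem) {v h : ℕ} {a : Fin n} (hv : env v = a) (hh : env h < n) :
    (scaledVal v h).eval n env mem = I.scaledVal a (env h) := by
  obtain ⟨b, hb⟩ : ∃ b : Fin n, env h = b := ⟨⟨env h, hh⟩, rfl⟩
  rw [scaledVal, eval_mul, eval_div, eval_commonDen hI]
  simp only [eval_load, eval_add, eval_one, eval_mul, eval_size, eval_var, hv, hb, Nat.reduceAdd,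
    hI.num, hI.den]
  simp [Instance.scaledVal]

theorem eval_scaledEnvy (hI : I.Holds mem) {u v : Fin n} (hu : env 31 = u) (hv : env 32 = v)
    (h35 : env 35 < n) (h36 : env 36 < n) :
    scaledEnvy.eval n env mem = I.scaledEnvy u v (env 35) (env 36) := by
  simp only [scaledEnvy, eval_add, eval_sub, eval_scaledVal hI hu h35, eval_scaledVal hI hu h36,
    eval_scaledVal hI hv h35, eval_scaledVal hI hv h36]
  rfl

/-- The power `2 ^ n`. -/
def twoPow : Expr := pow (const 2) size

/-- The mask of the set of all elements. -/
def fullMask : Expr := sum 22 (pow (const 2) (var 22))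

theorem eval_twoPow : twoPow.eval n env mem = 2 ^ n := by simp [twoPow]

theorem eval_fullMask : fullMask.eval n env mem = ∑ k ∈ Finset.range n, 2 ^ k := by
  rw [fullMask, eval_sum]
  refine Finset.sum_congr rfl fun k hk => ?_
  rw [eval_pow_const, eval_var, update_self, min_eq_left (Finset.mem_range.1 hk).le]

/-- The address of the table of vertex orders, the first cell after the input. -/
def orderTable : Expr := (1 + 1 + 1) * (size * size) + 1

/-- The address of the table of allocations. -/
def allocTable : Expr := orderTable + twoPow

theorem eval_orderTable : orderTable.eval n env mem = 3 * (n * n) + 1 := by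
  simp [orderTable]

theorem eval_allocTable : allocTable.eval n env mem = 3 * (n * n) + 1 + 2 ^ n := by
  simp [allocTable, eval_orderTable, eval_twoPow]

end Expr

/-- Write the houses of the allocation with code `var 1` into the first memory cells. -/
def outputCmd : Cmd := .loop 37 .size (.store (.var 37) (Expr.houseOf 37 - 1))

/-- Find an optimal allocation for the vertex order `var 2`, where `var 3` exceeds the cost of that
order. -/
def allocCmd : Cmd :=
  .seq (Search.cmd .allocTable (.twoPow * .var 3) .allocSig (.allocCost .scaledEnvy))
    (.letC 1 (.load (.allocTable + .fullMask * .var 3) - 1) outputCmd)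

/-- The number `W` that exceeds the cost of the vertex order `var 2`. -/
def orderBound : Expr := .letE 1 (.var 2) .widthCost + 1

/-- Solve an instance: search for a vertex order of small cost, and then for an allocation. -/
def mainCmd : Cmd :=
  .seq (Search.cmd .orderTable .twoPow .mask .widthCost)
    (.letC 2 (.load (.orderTable + .fullMask) - 1) (.letC 3 orderBound allocCmd))

section Correctness

variable {n : ℕ} (I : Instance n)

theorem exec_outputCmd {env mem : ℕ → ℕ} {O l : List (Fin n)} {π : Fin n ≃ Fin n} (hO : O.Nodup)
    (hfull : ∀ v, v ∈ O) (h1 : env 1 = code l) (h2 : env 2 = code O)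
    (hπ : ∀ v, houseOf O l v = π v + 1) (v : Fin n) :
    outputCmd.exec n env mem v = π v := by
  have key : ∀ j ≤ n, ∀ v : Fin n, v.val < j → iterMem (fun i m =>
      (Cmd.store (.var 37) (Expr.houseOf 37 - 1)).exec n (update env 37 i) m) j mem v = π v := by
    intro j
    induction j with
    | zero => exact fun _ v hv => absurd hv (Nat.not_lt_zero _)
    | succ j ih =>
      intro hj v hv
      rw [iterMem]
      simp only [Cmd.exec, Expr.eval_var, update_self]
      by_cases hvj : v.val = j
      · subst hvj
        rw [update_self, Expr.eval_sub, Expr.eval_houseOf (l := l) (a := v) hO hfull (by simp [h1])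
          (by simp [h2]) (by simp) (by simp), hπ]
        rfl
      · rw [update_of_ne hvj]
        exact ih (by omega) v (by omega)
  rw [outputCmd, Cmd.exec]
  exact key n le_rfl v v.2

theorem safe_outputCmd {env mem : ℕ → ℕ} {O l : List (Fin n)} {π : Fin n ≃ Fin n} (hO : O.Nodup)
    (hfull : ∀ v, v ∈ O) (h1 : env 1 = code l) (h2 : env 2 = code O)
    (hπ : ∀ v, houseOf O l v = π v + 1) {L : ℕ} (hn : n < 2 ^ L) :
    outputCmd.Safe n L env mem := by
  rw [outputCmd, Cmd.Safe]
  refine ⟨hn, fun j hj => ?_⟩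
  rw [Expr.eval_size] at hj
  simp only [Cmd.Safe]
  rw [Expr.eval_sub, Expr.eval_houseOf (l := l) (a := ⟨j, hj⟩) hO hfull (by simp [h1])
    (by simp [h2]) (by simp) (by simp), hπ]
  exact lt_of_le_of_lt (Nat.sub_le_of_le_add (by simp)) hn

theorem boundary_take_length {G : SimpleGraph (Fin n)} {O l : List (Fin n)} (hO : O.Nodup)
    (hfull : ∀ v, v ∈ O) (hl : l.Nodup) (hl' : ∀ v, v ∈ l) :
    boundary G (O.take l.length).toFinset = ∅ := by
  ext v
  simp only [mem_boundary, length_of_full hl hl', ← length_of_full hO hfull, List.take_length,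
    List.mem_toFinset, hfull]
  simp

theorem allocSig_full {G : SimpleGraph (Fin n)} {O l : List (Fin n)} (W : ℕ) (hO : O.Nodup)
    (hfull : ∀ v, v ∈ O) (hl : l.Nodup) (hl' : ∀ v, v ∈ l) :
    allocSig G O W l = (∑ k ∈ Finset.range n, 2 ^ k) * W := by
  rw [allocSig, boundary_take_length hO hfull hl hl', mask_full hl hl']
  simp [pack]

theorem mem_of_mask_eq {l : List (Fin n)} (hl : l.Nodup)
    (h : mask l = ∑ k ∈ Finset.range n, 2 ^ k) (v : Fin n) : v ∈ l := by
  rw [← mask_full (List.nodup_finRange n) List.mem_finRange] at h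
  have := toFinset_eq_of_mask_eq hl (List.nodup_finRange n) h
  rw [← List.mem_toFinset, this]
  simp

/-- The second half of the program finds an optimal allocation. -/
theorem allocCmd_correct {env mem : ℕ → ℕ} {O : List (Fin n)} {W : ℕ} (hO : O.Nodup)
    (hfull : ∀ v, v ∈ O) (h2 : env 2 = code O) (h3 : env 3 = W)
    (hW : ∀ m ≤ n, (n + 1) ^ (boundary I.graph (O.take m).toFinset).card ≤ W)
    (hI : I.Holds mem) (hmem : ∀ s, mem (3 * (n * n) + 1 + 2 ^ n + s) = 0) :
    (∃ π : Fin n ≃ Fin n, I.IsOptimal π ∧ ∀ v : Fin n, allocCmd.exec n env mem v = π v) ∧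
    ∀ L, (∀ a, mem a < 2 ^ L) → (n + 1) ^ n < 2 ^ L → n < 2 ^ L → 2 ^ n * W < 2 ^ L →
      allocCmd.Safe n L env mem := by
  have hdom := dominance_allocCost I.graph I.scaledEnvy hO hfull hW
  have hI' : ∀ mem', (∀ x < 3 * (n * n) + 1 + 2 ^ n, mem' x = mem x) → I.Holds mem' :=
    fun mem' h => hI.congr fun x hx => h x (hx.trans_le (Nat.le_add_right _ _))
  have hM : ∀ mem' : ℕ → ℕ, (Expr.twoPow * .var 3).eval n env mem' = 2 ^ n * W := fun mem' => by
    rw [Expr.eval_mul, Expr.eval_twoPow, Expr.eval_var, h3]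
  obtain ⟨T, hT, hrep, hcov⟩ := Search.exec_cmd (env₀ := env) (mem₀ := mem)
    (sigE := Expr.allocSig) (costE := Expr.allocCost Expr.scaledEnvy) (M := .twoPow * .var 3)
    hdom (fun _ _ => Expr.eval_allocTable)
    (fun env' mem' l hl e1 e2 e3 hm => by
      rw [Expr.eval_allocSig (hI' mem' hm).graph hO hfull hl e1 (e2.trans h2), e3, h3])
    (fun env' mem' l hl e1 e2 e3 hm =>
      Expr.eval_allocCost (hI' mem' hm).graph hO hfull e1 (e2.trans h2)
        fun env u v hu hv h35 h36 => Expr.eval_scaledEnvy (hI' mem' hm) hu hv h35 h36)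
    (fun l h hl => by
      have hln := (nodup_append_singleton.1 hl).1
      rw [hM]
      refine (allocSig_lt I.graph hW (length_le_of_nodup hln)).trans_le ?_
      exact Nat.mul_le_mul_right _ (mask_lt hln)) hmem
  have hfullSig := fun l hl hl' => allocSig_full (G := I.graph) (l := l) W hO hfull hl hl'
  obtain ⟨l, hTl, -⟩ := hcov O hO
  obtain ⟨hl, hsl⟩ := hT _ _ hTl
  rw [hfullSig O hO hfull] at hTl hsl
  have hl' : ∀ v, v ∈ l := by
    refine mem_of_mask_eq hl ?_
    have hlt := allocSig_lt I.graph hW (length_le_of_nodup hl)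
    have hle : mask l * W ≤ allocSig I.graph O W l := Nat.le_add_right _ _
    rw [hsl] at hlt hle
    have hpos : 0 < W := lt_of_lt_of_le (by positivity) (hW 0 (Nat.zero_le _))
    have h4 := Nat.le_of_mul_le_mul_right hle hpos
    have h5 := Nat.lt_of_mul_lt_mul_right hlt
    omega
  obtain ⟨π, hπ⟩ := exists_equiv_houseOf hO hfull hl hl'
  set mem₁ := (Search.cmd Expr.allocTable (.twoPow * .var 3) Expr.allocSig
    (Expr.allocCost Expr.scaledEnvy)).exec n env mem with hmem₁
  have hload : (Expr.load (.allocTable + .fullMask * .var 3) - 1).eval n env mem₁ = code l := by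
    rw [Expr.eval_sub, Expr.eval_load, Expr.eval_add, Expr.eval_allocTable, Expr.eval_mul,
      Expr.eval_fullMask, Expr.eval_var, h3, hrep.2, hTl]
    rfl
  refine ⟨⟨π, fun π' => ?_, fun v => ?_⟩, fun L hL h4 h5 h6 => ?_⟩
  · have hnd : (O.map π').Nodup := hO.map π'.injective
    have hfl : ∀ v, v ∈ O.map π' := fun v =>
      List.mem_map.2 ⟨π'.symm v, hfull _, π'.apply_symm_apply v⟩
    obtain ⟨l₁, hl₁, hle⟩ := hcov _ hnd
    rw [hfullSig _ hnd hfl, hTl, Option.some_inj] at hl₁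
    subst hl₁
    exact I.totalEnvy_le_of_allocCost_le hπ (houseOf_map hfull π') hle
  · simp only [allocCmd, Cmd.exec]
    rw [← hmem₁, hload]
    exact exec_outputCmd hO hfull (by simp) (by simp [h2]) hπ v
  · rw [allocCmd, Cmd.Safe, Cmd.Safe]
    refine ⟨Search.safe_cmd h4 h5 (by rwa [hM]) hL, ?_⟩
    rw [← hmem₁]
    refine ⟨?_, ?_⟩ <;> rw [hload]
    · exact (code_lt_of_nodup hl).trans h4
    · exact safe_outputCmd hO hfull (by simp) (by simp [h2]) hπ h5

/-- The time of `mainCmd`, relative to the number of cells of the tables. -/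
def mainTime (n : ℕ) : ℕ :=
  Search.baseTime .orderTable .twoPow n + Search.cellTime .orderTable .mask .widthCost n +
    (Expr.load (.orderTable + .fullMask) - 1).time n + orderBound.time n +
    Search.baseTime .allocTable (.twoPow * .var 3) n +
    Search.cellTime .allocTable .allocSig (.allocCost .scaledEnvy) n +
    (Expr.load (.allocTable + .fullMask * .var 3) - 1).time n +
    (5 + n * ((Expr.houseOf 37 - 1).time n + 7))

theorem polyBounded_mainTime : PolyBounded fun n _ => mainTime n :=
  (((((((Search.polyBounded_baseTime _ _).add (Search.polyBounded_cellTime _ _ _)).add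
    (Expr.polyBounded_time _)).add (Expr.polyBounded_time _)).add
    (Search.polyBounded_baseTime _ _)).add (Search.polyBounded_cellTime _ _ _)).add
    (Expr.polyBounded_time _)).add
    ((PolyBounded.const 5).add (PolyBounded.fst.mul ((Expr.polyBounded_time _).add (.const 7))))

theorem time_mainCmd_le {env mem : ℕ → ℕ} {W : ℕ} (hW : 0 < W)
    (h : orderBound.eval n (update env 2 ((Expr.load (.orderTable + .fullMask) - 1).eval n env
      ((Search.cmd .orderTable .twoPow .mask .widthCost).exec n env mem)))
      ((Search.cmd .orderTable .twoPow .mask .widthCost).exec n env mem) = W) :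
    mainCmd.time n env mem ≤ 2 ^ n * W * mainTime n := by
  have h37 : (Expr.var 37).time n = 2 := rfl
  have hsz : Expr.size.time n = 2 := rfl
  simp only [mainCmd, Cmd.time, allocCmd, Search.time_cmd, outputCmd, h, Expr.eval_twoPow,
    Expr.eval_mul, Expr.eval_var, update_self, Expr.eval_size, Finset.sum_const, Finset.card_range,
    smul_eq_mul, h37, hsz, mainTime]
  have h1 : 2 ^ n ≤ 2 ^ n * W := Nat.le_mul_of_pos_right _ hW
  have h2 : 1 ≤ 2 ^ n * W := Nat.mul_pos (by positivity) hW
  generalize 2 ^ n * W = X at h1 h2 ⊢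
  generalize 2 ^ n = Y at h1 ⊢
  have key : ∀ a, a ≤ X * a := fun a => Nat.le_mul_of_pos_left _ h2
  simp only [mul_add]
  have k1 := key (Search.baseTime .orderTable .twoPow n)
  have k2 := Nat.mul_le_mul_right (Search.cellTime .orderTable .mask .widthCost n) h1
  have k3 := key ((Expr.load (.orderTable + .fullMask) - 1).time n)
  have k4 := key (orderBound.time n)
  have k5 := key (Search.baseTime .allocTable (.twoPow * .var 3) n)
  have k6 := key ((Expr.load (.allocTable + .fullMask * .var 3) - 1).time n)
  have k7 := key (n * (Expr.houseOf 37 - 1).time n)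
  have k8 := key n
  have k9 : X * (n * 7) = X * n * 7 := by ring
  omega

/-- The program finds an optimal allocation, within a time bounded in terms of the best vertex
order. -/
theorem mainCmd_correct {env mem : ℕ → ℕ} (hI : I.Holds mem)
    (hmem : ∀ a, 3 * (n * n) + 1 ≤ a → mem a = 0) {o : List (Fin n)} (ho : o.Nodup)
    (ho' : ∀ v, v ∈ o) :
    (∃ π : Fin n ≃ Fin n, I.IsOptimal π ∧ ∀ v : Fin n, mainCmd.exec n env mem v = π v) ∧
    mainCmd.time n env mem ≤ 2 ^ n * (widthCost I.graph o + 1) * mainTime n ∧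
    ∀ L, (∀ a, mem a < 2 ^ L) → 2 ^ n * (n * (n + 1) ^ n + 1) < 2 ^ L →
      mainCmd.Safe n L env mem := by
  have hI' : ∀ mem', (∀ x < 3 * (n * n) + 1, mem' x = mem x) → I.Holds mem' :=
    fun mem' h => hI.congr h
  obtain ⟨T, hT, hrep, hcov⟩ := Search.exec_cmd (env₀ := env) (mem₀ := mem)
    (sigE := Expr.mask) (costE := Expr.widthCost) (M := .twoPow)
    (dominance_widthCost I.graph) (fun _ _ => Expr.eval_orderTable)
    (fun env' mem' l hl e1 e2 e3 hm => Expr.eval_mask hl e1)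
    (fun env' mem' l hl e1 e2 e3 hm => Expr.eval_widthCost (hI' mem' hm).graph hl e1)
    (fun l h hl => by
      rw [Expr.eval_twoPow]
      exact mask_lt (nodup_append_singleton.1 hl).1) fun s => hmem _ (Nat.le_add_right _ _)
  obtain ⟨O, hTO, hle⟩ := hcov o ho
  obtain ⟨hO, hsO⟩ := hT _ _ hTO
  rw [mask_full ho ho'] at hTO hsO
  have hfull := mem_of_mask_eq hO hsO
  have htime := time_mainCmd_le (n := n) (env := env) (mem := mem)
    (W := widthCost I.graph O + 1) (Nat.succ_pos _)
  set mem₁ := (Search.cmd .orderTable .twoPow .mask .widthCost).exec n env mem with hmem₁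
  have hload : (Expr.load (.orderTable + .fullMask) - 1).eval n env mem₁ = code O := by
    rw [Expr.eval_sub, Expr.eval_load, Expr.eval_add, Expr.eval_orderTable, Expr.eval_fullMask,
      hrep.2, hTO]
    rfl
  have hI₁ := hI' mem₁ hrep.1
  have hbound : orderBound.eval n (update env 2 (code O)) mem₁ = widthCost I.graph O + 1 := by
    rw [orderBound, Expr.eval_add, Expr.eval_letE, Expr.eval_widthCost hI₁.graph hO (by simp)]
    rfl
  have hW : ∀ m ≤ n, (n + 1) ^ (boundary I.graph (O.take m).toFinset).card ≤
      widthCost I.graph O + 1 := fun m hm =>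
    pow_card_boundary_le I.graph m (by rwa [length_of_full hO hfull])
  have hzero : ∀ s, mem₁ (3 * (n * n) + 1 + 2 ^ n + s) = 0 := by
    intro s
    rw [add_assoc, hrep.2]
    cases h : T (2 ^ n + s) with
    | none => rfl
    | some l =>
      obtain ⟨hl, hs⟩ := hT _ _ h
      have := mask_lt hl
      omega
  obtain ⟨hsol, hsafe⟩ := allocCmd_correct I
    (env := update (update env 2 (code O)) 3 (widthCost I.graph O + 1)) hO hfull
    (by simp) (by simp) hW hI₁ hzero
  rw [hload] at htime
  refine ⟨?_, (htime hbound).trans ?_, fun L hL hlt => ?_⟩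
  · simp only [mainCmd, Cmd.exec]
    rw [← hmem₁, hload, hbound]
    exact hsol
  · gcongr
  · have hWle : widthCost I.graph O ≤ n * (n + 1) ^ n :=
      widthCost_le I.graph (length_le_of_nodup hO) fun i => card_finset_fin_le _
    have h1 : 2 ^ n * (widthCost I.graph O + 1) < 2 ^ L :=
      lt_of_le_of_lt (Nat.mul_le_mul_left _ (by omega)) hlt
    have h0 : 1 ≤ 2 ^ n := Nat.one_le_two_pow
    have h2 : (n * (n + 1) ^ n + 1) < 2 ^ L :=
      lt_of_le_of_lt (Nat.le_mul_of_pos_left _ h0) hlt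
    have h3 : n < 2 ^ L := by
      have : n * 1 ≤ n * (n + 1) ^ n := Nat.mul_le_mul_left _ (Nat.one_le_pow _ _ (by omega))
      omega
    have h4 : (n + 1) ^ n < 2 ^ L := by
      rcases Nat.eq_zero_or_pos n with hn | hn
      · subst hn
        simp at h2 hlt ⊢
        omega
      · have : 1 * (n + 1) ^ n ≤ n * (n + 1) ^ n := Nat.mul_le_mul_right _ hn
        omega
    have h5 : 2 ^ n < 2 ^ L := lt_of_le_of_lt (Nat.le_mul_of_pos_right _ (by omega)) h1
    have hs := Search.safe_cmd (A := .orderTable) (M := .twoPow) (sigE := .mask)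
      (costE := .widthCost) (env := env) (mem := mem) h4 h3 (by rwa [Expr.eval_twoPow]) hL
    rw [mainCmd, Cmd.Safe, Cmd.Safe, Cmd.Safe, ← hmem₁, hload, hbound]
    exact ⟨hs, (code_lt_of_nodup hO).trans h4, by omega, hsafe L (Cmd.exec_lt _ hs hL) h4 h3 h1⟩

end Correctness

/-! ### Graphs with good vertex orders -/

/-- There is an order of the vertices whose initial segments have boundaries of size at most `w`
(the vertex separation number of `G` is at most `w`). -/
def HasVertexOrder {n : ℕ} (G : SimpleGraph (Fin n)) (w : ℕ) : Prop :=
  ∃ o : List (Fin n), o.Nodup ∧ (∀ v, v ∈ o) ∧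
    ∀ i, (boundary G (o.take i).toFinset).card ≤ w

/-- The program `mainCmd.program` is fast on all classes of graphs with vertex orders for which the
signatures of boundaries number at most `2 ^ n` up to a constant factor. -/
theorem solvableInOStar_of_hasVertexOrder {𝒢 : GraphClass} (D : ℕ)
    (h : ∀ n G, 𝒢 n G → ∃ w, HasVertexOrder G w ∧ (n + 1) ^ w ≤ D * 2 ^ n) :
    SolvableInOStar 𝒢 fun n => 4 ^ n := by
  obtain ⟨C₁, c₁, h₁⟩ := polyBounded_mainTime
  -- every number that occurs has at most `L n b` bits, where `b` is the bit length of the input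
  set L : ℕ → ℕ → ℕ := fun n b => n * n + 2 * n + 1 + b with hLdef
  have hLpoly : PolyBounded L :=
    (((PolyBounded.fst.mul .fst).add ((PolyBounded.const 2).mul .fst)).add (.const 1)).add .snd
  obtain ⟨C₂, c₂, h₂⟩ := ((mainCmd.polyBounded_bits.comp hLpoly).add hLpoly).add (.const 1)
  refine ⟨mainCmd.program, D * (C₁ + 1) * (C₂ + 1), c₁ + 1 + c₂, fun n I hI => ?_⟩
  obtain ⟨w, ⟨o, ho, ho', hw⟩, hD⟩ := h n I.graph hI
  set b := I.bitLength
  have hB : n + 1 ≤ 2 ^ n := Nat.lt_two_pow_self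
  have hlt : 2 ^ n * (n * (n + 1) ^ n + 1) < 2 ^ L n b := by
    have h3 : n * (n + 1) ^ n + 1 ≤ (n + 1) ^ (n + 1) := by
      rw [pow_succ, mul_add, mul_one, mul_comm]
      have : 1 ≤ (n + 1) ^ n := Nat.one_le_pow _ _ (by omega)
      omega
    calc 2 ^ n * (n * (n + 1) ^ n + 1) ≤ 2 ^ n * (2 ^ n) ^ (n + 1) :=
          Nat.mul_le_mul_left _ (h3.trans (Nat.pow_le_pow_left hB _))
      _ = 2 ^ (n * n + 2 * n) := by rw [← pow_mul, ← pow_add]; ring_nf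
      _ < 2 ^ L n b := Nat.pow_lt_pow_right (by omega) (by simp only [hLdef]; omega)
  have hnL : n < 2 ^ L n b :=
    (Nat.lt_two_pow_self (n := n)).trans_le (Nat.pow_le_pow_right (by omega) (by
      simp only [hLdef]; omega))
  have hL1 : 1 < 2 ^ L n b := Nat.one_lt_two_pow (by simp only [hLdef]; omega)
  have hmem := I.encode_getD_lt hnL hL1 (by simp only [hLdef]; omega)
  obtain ⟨⟨π, hπ, hout⟩, htime, hsafe⟩ := mainCmd_correct I (env := fun _ => n) I.holds_encode
    (fun a ha => I.encode_getD_of_le ha) ho ho'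
  obtain ⟨s, hs, hhalt, hcost, hfin⟩ :=
    mainCmd.run_program I.encode_getD_zero hmem (hsafe _ hmem hlt)
  have hwc : widthCost I.graph o + 1 ≤ (n + 1) * (n + 1) ^ w := by
    have h3 := widthCost_le I.graph (length_le_of_nodup ho) hw
    have h4 : 1 ≤ (n + 1) ^ w := Nat.one_le_pow _ _ (by omega)
    rw [add_mul, one_mul]
    omega
  have hpos : 1 ≤ 4 ^ n * (n + 1) ^ (c₁ + 1) := Nat.mul_pos (by positivity) (by positivity)
  have hDpos : 1 ≤ D := by
    by_contra hD0
    have : D = 0 := by omega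
    rw [this, zero_mul] at hD
    have : 0 < (n + 1) ^ w := by positivity
    omega
  have hsteps : s ≤ D * (C₁ + 1) * 4 ^ n * (n + 1) ^ (c₁ + 1) := by
    have h3 : mainTime n ≤ C₁ * (n + 1) ^ c₁ := h₁ n 0
    have h4 : 2 ^ n * (widthCost I.graph o + 1) * mainTime n ≤
        D * C₁ * (4 ^ n * (n + 1) ^ (c₁ + 1)) :=
      calc 2 ^ n * (widthCost I.graph o + 1) * mainTime n
          ≤ 2 ^ n * ((n + 1) * (D * 2 ^ n)) * (C₁ * (n + 1) ^ c₁) :=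
            Nat.mul_le_mul (Nat.mul_le_mul_left _ (hwc.trans (Nat.mul_le_mul_left _ hD))) h3
        _ = _ := by
          rw [show (4 : ℕ) = 2 * 2 by norm_num, mul_pow]
          ring
    have h5 : 1 ≤ D * (4 ^ n * (n + 1) ^ (c₁ + 1)) := Nat.mul_pos hDpos hpos
    calc s ≤ D * C₁ * (4 ^ n * (n + 1) ^ (c₁ + 1)) + D * (4 ^ n * (n + 1) ^ (c₁ + 1)) := by omega
      _ = _ := by ring
  have hbits : mainCmd.bits n (L n b) + L n b + 1 ≤
      (C₂ + 1) * ((n + 1) ^ c₂ * (b + 1) ^ c₂) := by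
    refine (h₂ n b).trans (Nat.mul_le_mul (Nat.le_succ _) ?_)
    rw [← mul_pow]
    exact Nat.pow_le_pow_left (by nlinarith) _
  refine ⟨s, hsteps.trans ?_, hhalt, hcost.trans ?_, π, hπ, fun v => by rw [hfin]; exact hout v⟩
  · have h3 : (n + 1) ^ (c₁ + 1) ≤ (n + 1) ^ (c₁ + 1 + c₂) :=
      Nat.pow_le_pow_right (by omega) (by omega)
    have h4 : D * (C₁ + 1) * 4 ^ n ≤ D * (C₁ + 1) * (C₂ + 1) * 4 ^ n :=
      Nat.mul_le_mul_right _ (Nat.le_mul_of_pos_right _ (by omega))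
    exact Nat.mul_le_mul h4 h3
  · have h3 : (b + 1) ^ c₂ ≤ (b + 1) ^ (c₁ + 1 + c₂) :=
      Nat.pow_le_pow_right (by omega) (by omega)
    calc s * (mainCmd.bits n (L n b) + L n b + 1)
        ≤ D * (C₁ + 1) * 4 ^ n * (n + 1) ^ (c₁ + 1) *
          ((C₂ + 1) * ((n + 1) ^ c₂ * (b + 1) ^ c₂)) := Nat.mul_le_mul hsteps hbits
      _ = D * (C₁ + 1) * (C₂ + 1) * 4 ^ n * (n + 1) ^ (c₁ + 1 + c₂) * (b + 1) ^ c₂ := by ring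
      _ ≤ _ := Nat.mul_le_mul_left _ h3

/-- Powers of `n + 1` with logarithmic exponent grow more slowly than `2 ^ n`. -/
theorem exists_pow_log_le (K : ℕ) : ∃ D, ∀ n : ℕ, (n + 1) ^ (K * (Nat.log 2 n + 1)) ≤ D * 2 ^ n := by
  obtain ⟨E, hE⟩ : ∃ E, ∀ m : ℕ, K * (m + 1) ^ 2 ≤ 2 ^ m + E := by
    have h1 : Filter.Tendsto (fun m : ℕ => (m : ℝ) ^ 2 / 2 ^ m) Filter.atTop (nhds 0) :=
      tendsto_pow_const_div_const_pow_of_one_lt 2 (by norm_num)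
    have h2 := h1.eventually (ge_mem_nhds (show (0 : ℝ) < 1 / (4 * K + 1) by positivity))
    obtain ⟨N, hN⟩ := Filter.eventually_atTop.1 h2
    refine ⟨K * (N + 2) ^ 2, fun m => ?_⟩
    by_cases h : N ≤ m ∧ 0 < m
    · have h3 := hN m h.1
      rw [div_le_div_iff₀ (by positivity) (by positivity)] at h3
      have h4 : m ^ 2 * (4 * K + 1) ≤ 1 * 2 ^ m := by exact_mod_cast h3
      have h5 : (m + 1) ^ 2 ≤ 4 * m ^ 2 := by nlinarith [h.2]
      nlinarith
    · have h3 : (m + 1) ^ 2 ≤ (N + 2) ^ 2 := Nat.pow_le_pow_left (by omega) 2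
      exact (Nat.mul_le_mul_left K h3).trans (Nat.le_add_left _ _)
  refine ⟨2 ^ (E + 1), fun n => ?_⟩
  set m := Nat.log 2 n with hm
  have h1 : n + 1 ≤ 2 ^ (m + 1) := Nat.lt_pow_succ_log_self (by omega) n
  have h2 : 2 ^ m ≤ n + 1 := by
    by_cases hn : n = 0
    · simp [hm, hn]
    · exact (Nat.pow_log_le_self 2 hn).trans (Nat.le_succ n)
  calc (n + 1) ^ (K * (m + 1)) ≤ (2 ^ (m + 1)) ^ (K * (m + 1)) := Nat.pow_le_pow_left h1 _
    _ = 2 ^ (K * (m + 1) ^ 2) := by rw [← pow_mul]; ring_nf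
    _ ≤ 2 ^ (E + 1 + n) := Nat.pow_le_pow_right (by omega) (by have := hE m; omega)
    _ = 2 ^ (E + 1) * 2 ^ n := pow_add _ _ _

/-! ### Centroids of forests -/

section Centroid

variable {V W : Type*} {T : SimpleGraph W}

/-- A walk that cannot reach `t` may be moved to the graph without the edges at `t`. -/
theorem reachable_deleteIncidenceSet_of_not_reachable {s t z y : W}
    (h : (T.deleteIncidenceSet s).Reachable z y) (ht : ¬ (T.deleteIncidenceSet s).Reachable z t) :
    (T.deleteIncidenceSet t).Reachable z y := by
  rw [SimpleGraph.reachable_iff_reflTransGen] at h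
  induction h with
  | refl => exact .refl _
  | @tail b c hb hbc ih =>
    rw [← SimpleGraph.reachable_iff_reflTransGen] at hb
    refine ih.trans (SimpleGraph.Adj.reachable ?_)
    refine SimpleGraph.deleteIncidenceSet_adj.2
      ⟨(SimpleGraph.deleteIncidenceSet_adj.1 hbc).1, ?_, ?_⟩
    · rintro rfl
      exact ht hb
    · rintro rfl
      exact ht (hb.trans hbc.reachable)

theorem eq_of_reachable_deleteIncidenceSet {t x : W} (h : (T.deleteIncidenceSet t).Reachable x t) :
    x = t := by
  rw [SimpleGraph.reachable_iff_reflTransGen] at h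
  rcases h.cases_tail with h | ⟨b, -, hb⟩
  · exact h.symm
  · exact absurd rfl (SimpleGraph.deleteIncidenceSet_adj.1 hb).2.2

/-- The first step of a path from `t` to `y`. -/
theorem exists_adj_reachable_deleteIncidenceSet {t y : W} (h : T.Reachable t y) :
    y = t ∨ ∃ s, T.Adj t s ∧ (T.deleteIncidenceSet t).Reachable s y := by
  rw [SimpleGraph.reachable_iff_reflTransGen] at h
  induction h with
  | refl => exact .inl rfl
  | @tail b c hb hbc ih =>
    by_cases hc : c = t
    · exact .inl hc
    · right
      rcases ih with rfl | ⟨s, hs, hsb⟩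
      · exact ⟨c, hbc, .refl _⟩
      · by_cases hbt : b = t
        · subst hbt
          exact ⟨c, hbc, .refl _⟩
        · exact ⟨s, hs, hsb.trans
            (SimpleGraph.deleteIncidenceSet_adj.2 ⟨hbc, hbt, hc⟩ :
              (T.deleteIncidenceSet t).Adj b c).reachable⟩

/-- Let `T` be a forest and `x t` a vertex other than `t`. Then one can move from `t` to a vertex
`s` in the component of `x t` in the forest without `t`, so that the component of `t` without `s`
does not meet that component. -/
theorem exists_step (hT : T.IsAcyclic) {t x : W} (hx : x ≠ t) :
    ∃ s, (T.deleteIncidenceSet t).Reachable x s ∧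
      ∀ z, (T.deleteIncidenceSet t).Reachable x z → ¬ (T.deleteIncidenceSet s).Reachable z t := by
  by_cases htx : T.Reachable t x
  · rcases exists_adj_reachable_deleteIncidenceSet htx with rfl | ⟨s, hts, hsx⟩
    · exact absurd rfl hx
    · refine ⟨s, hsx.symm, fun z hxz hzt => ?_⟩
      have hbridge := SimpleGraph.isBridge_iff.1
        (SimpleGraph.isAcyclic_iff_forall_adj_isBridge.1 hT hts)
      have h1 : T.deleteIncidenceSet t ≤ T.deleteEdges {s(t, s)} := by
        intro a b hab
        obtain ⟨h, ha, hb⟩ := SimpleGraph.deleteIncidenceSet_adj.1 hab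
        simp [h, ha, hb]
      have h2 : T.deleteIncidenceSet s ≤ T.deleteEdges {s(t, s)} := by
        intro a b hab
        obtain ⟨h, ha, hb⟩ := SimpleGraph.deleteIncidenceSet_adj.1 hab
        simp [h, ha, hb]
      exact hbridge ((hzt.mono h2).symm.trans ((hsx.trans hxz).mono h1).symm)
  · refine ⟨x, .refl _, fun z hxz hzt => htx ?_⟩
    exact ((hxz.mono (SimpleGraph.deleteIncidenceSet_le _ _)).trans
      (hzt.mono (SimpleGraph.deleteIncidenceSet_le _ _))).symm

open Classical in
/-- Let a nonempty set `N v` of vertices of a forest be given for each `v ∈ A`. Then the forest has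
a vertex `t` such that for each component of the forest without `t`, at most half of the sets are
contained in that component. -/
theorem exists_centroid [Finite W] [Nonempty W] (hT : T.IsAcyclic) (A : Finset V) (N : V → Set W)
    (hN : ∀ v, (N v).Nonempty) :
    ∃ t, ∀ x, 2 * (A.filter fun v => ∀ y ∈ N v, y ≠ t ∧
      (T.deleteIncidenceSet t).Reachable x y).card ≤ A.card := by
  obtain ⟨S, hS⟩ : ∃ S : W → W → Finset V, ∀ t x, S t x = A.filter fun v => ∀ y ∈ N v, y ≠ t ∧
      (T.deleteIncidenceSet t).Reachable x y := ⟨_, fun _ _ => rfl⟩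
  have hmem : ∀ t x v, v ∈ S t x ↔ v ∈ A ∧ ∀ y ∈ N v, y ≠ t ∧
      (T.deleteIncidenceSet t).Reachable x y := fun t x v => by rw [hS, Finset.mem_filter]
  simp only [← hS]
  have := Fintype.ofFinite W
  by_contra! hcon
  choose x hx using hcon
  have hxt : ∀ t, x t ≠ t := by
    intro t h
    have hempty : S t (x t) = ∅ := by
      refine Finset.eq_empty_of_forall_notMem fun v hv => ?_
      obtain ⟨y, hy⟩ := hN v
      obtain ⟨h1, h2⟩ := ((hmem _ _ _).1 hv).2 y hy
      rw [h] at h2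
      exact h1 (eq_of_reachable_deleteIncidenceSet h2.symm)
    have := hx t
    rw [hempty] at this
    simp at this
  -- choose `t` such that the heavy component of the forest without `t` is as small as possible
  obtain ⟨t, -, ht⟩ := Finset.exists_min_image Finset.univ (fun t => (Finset.univ.filter fun y =>
    (T.deleteIncidenceSet t).Reachable (x t) y).card) Finset.univ_nonempty
  obtain ⟨s, hs, hst⟩ := exists_step hT (hxt t)
  -- both heavy components contain more than half of the sets, hence they share one
  obtain ⟨v, hv⟩ : (S t (x t) ∩ S s (x s)).Nonempty := by
    rw [Finset.nonempty_iff_ne_empty]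
    intro hempty
    have h1 := Finset.card_union_of_disjoint (Finset.disjoint_iff_inter_eq_empty.2 hempty)
    have h2 := Finset.card_le_card (Finset.union_subset (fun v hv => ((hmem t (x t) v).1 hv).1)
      (fun v hv => ((hmem s (x s) v).1 hv).1))
    have h3 := hx t
    have h4 := hx s
    omega
  rw [Finset.mem_inter, hmem, hmem] at hv
  obtain ⟨z, hz⟩ := hN v
  have hzt := (hv.1.2 z hz).2
  have hzs := (hv.2.2 z hz).2
  refine absurd (ht s (Finset.mem_univ _)) (not_le.2 (Finset.card_lt_card ?_))
  rw [Finset.ssubset_iff_of_subset]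
  · refine ⟨s, by simpa using hs, ?_⟩
    rw [Finset.mem_filter]
    exact fun h => hxt s (eq_of_reachable_deleteIncidenceSet h.2)
  · intro y hy
    rw [Finset.mem_filter] at hy ⊢
    exact ⟨Finset.mem_univ _, hzt.trans
      (reachable_deleteIncidenceSet_of_not_reachable (hzs.symm.trans hy.2) (hst z hzt))⟩

end Centroid

/-! ### Balanced separators and vertex orders -/

section Separator

variable {V : Type*} (G : SimpleGraph V)

open Classical in
/-- Every set `A` of vertices can be separated by at most `K` vertices into parts (the fibres of `c`)
with at most `|A| / 2` elements. -/
def HasSeparators (K : ℕ) : Prop :=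
  ∀ A : Finset V, ∃ X : Finset V, X.card ≤ K ∧ ∃ (ι : Type) (c : V → ι),
    (∀ u ∈ A, ∀ v ∈ A, u ∉ X → v ∉ X → G.Adj u v → c u = c v) ∧
    ∀ i, 2 * (A.filter fun v => v ∉ X ∧ c v = i).card ≤ A.card

open Classical in
/-- There is an order of the vertices of `A` whose initial segments have at most `w` elements with a
neighbour in the rest of `A`. -/
def HasOrderOn (A : Finset V) (w : ℕ) : Prop :=
  ∃ o : List V, o.Nodup ∧ (∀ v, v ∈ o ↔ v ∈ A) ∧
    ∀ l₁ l₂, o = l₁ ++ l₂ → (l₁.toFinset.filter fun v => ∃ u ∈ l₂, G.Adj v u).card ≤ w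

variable {G}

theorem hasOrderOn_empty (w : ℕ) : HasOrderOn G ∅ w :=
  ⟨[], List.nodup_nil, by simp, fun l₁ l₂ h => by simp [(List.nil_eq_append_iff.1 h).1]⟩

open Classical in
/-- Sets without edges between them may be listed one after the other. -/
theorem HasOrderOn.union {A B : Finset V} {w : ℕ} (hA : HasOrderOn G A w) (hB : HasOrderOn G B w)
    (hdisj : Disjoint A B) (hadj : ∀ u ∈ A, ∀ v ∈ B, ¬ G.Adj u v) : HasOrderOn G (A ∪ B) w := by
  obtain ⟨a, ha, ha', haw⟩ := hA
  obtain ⟨b, hb, hb', hbw⟩ := hB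
  refine ⟨a ++ b, List.nodup_append.2 ⟨ha, hb, fun u hu v hv huv => ?_⟩, fun v => ?_,
    fun l₁ l₂ h => ?_⟩
  · subst huv
    exact Finset.disjoint_left.1 hdisj ((ha' u).1 hu) ((hb' u).1 hv)
  · rw [List.mem_append, Finset.mem_union, ha', hb']
  · rcases List.append_eq_append_iff.1 h with ⟨c, rfl, rfl⟩ | ⟨c, rfl, rfl⟩
    · refine le_trans (Finset.card_le_card fun v hv => ?_) (hbw c l₂ rfl)
      simp only [Finset.mem_filter, List.mem_toFinset, List.mem_append] at hv ⊢
      obtain ⟨hv | hv, u, hu, huv⟩ := hv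
      · exact absurd huv (hadj v ((ha' v).1 hv) u ((hb' u).1 (List.mem_append_right _ hu)))
      · exact ⟨hv, u, hu, huv⟩
    · refine le_trans (Finset.card_le_card fun v hv => ?_) (haw l₁ c rfl)
      simp only [Finset.mem_filter, List.mem_toFinset, List.mem_append] at hv ⊢
      obtain ⟨hv, u, hu | hu, huv⟩ := hv
      · exact ⟨hv, u, hu, huv⟩
      · exact absurd huv (hadj v ((ha' v).1 (List.mem_append_left _ hv)) u ((hb' u).1 hu))

open Classical in
/-- Elements listed in front of everything else contribute at most their number. -/
theorem HasOrderOn.union_left {A : Finset V} {w : ℕ} (hA : HasOrderOn G A w) (X : Finset V)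
    (hdisj : Disjoint X A) : HasOrderOn G (X ∪ A) (X.card + w) := by
  obtain ⟨a, ha, ha', haw⟩ := hA
  refine ⟨X.toList ++ a, List.nodup_append.2 ⟨X.nodup_toList, ha, fun u hu v hv huv => ?_⟩,
    fun v => by simp [ha'], fun l₁ l₂ h => ?_⟩
  · subst huv
    exact Finset.disjoint_left.1 hdisj (Finset.mem_toList.1 hu) ((ha' u).1 hv)
  · rcases List.append_eq_append_iff.1 h with ⟨c, rfl, rfl⟩ | ⟨c, hc, rfl⟩
    · refine le_trans (Finset.card_le_card (t := X ∪ c.toFinset.filter fun v => ∃ u ∈ l₂, G.Adj v u)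
        fun v hv => ?_) ((Finset.card_union_le _ _).trans (Nat.add_le_add_left (haw c l₂ rfl) _))
      simp only [Finset.mem_filter, List.mem_toFinset, List.mem_append, Finset.mem_union,
        Finset.mem_toList] at hv ⊢
      tauto
    · refine le_trans (Finset.card_le_card fun v hv => ?_) (Nat.le_add_right _ _)
      rw [← Finset.mem_toList, hc]
      simp only [Finset.mem_filter, List.mem_toFinset] at hv
      exact List.mem_append_left _ hv.1

open Classical in
/-- A set with less than `2 ^ j` elements is ordered by listing first a separator, and then the parts
one after the other, each in an order given by induction. Hence at most the separators of `j` levels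
are on the boundary at the same time. -/
theorem HasSeparators.hasOrderOn {K : ℕ} (hG : HasSeparators G K) (j : ℕ) :
    ∀ A : Finset V, A.card < 2 ^ j → HasOrderOn G A (K * j) := by
  induction j with
  | zero =>
    intro A hA
    obtain rfl : A = ∅ := by simpa using hA
    exact hasOrderOn_empty _
  | succ j ih =>
    intro A hA
    obtain ⟨X, hX, ι, c, hadj, hhalf⟩ := hG A
    have hpart : ∀ i, HasOrderOn G (A.filter fun v => v ∉ X ∧ c v = i) (K * j) := fun i =>
      ih _ (by have := hhalf i; rw [pow_succ] at hA; omega)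
    have hparts : ∀ S : Finset ι, HasOrderOn G (A.filter fun v => v ∉ X ∧ c v ∈ S) (K * j) := by
      intro S
      induction S using Finset.induction_on with
      | empty =>
        simp only [Finset.notMem_empty, and_false, Finset.filter_false]
        exact hasOrderOn_empty _
      | insert i S hi ihS =>
        have hsplit : (A.filter fun v => v ∉ X ∧ c v ∈ insert i S) =
            (A.filter fun v => v ∉ X ∧ c v = i) ∪ (A.filter fun v => v ∉ X ∧ c v ∈ S) := by
          ext v
          simp only [Finset.mem_filter, Finset.mem_union, Finset.mem_insert]
          tauto
        rw [hsplit]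
        refine (hpart i).union ihS (Finset.disjoint_left.2 fun v hv hv' => ?_)
          fun u hu v hv huv => ?_
        · rw [Finset.mem_filter] at hv hv'
          exact hi (hv.2.2 ▸ hv'.2.2)
        · rw [Finset.mem_filter] at hu hv
          have := hadj u hu.1 v hv.1 hu.2.1 hv.2.1 huv
          exact hi (hu.2.2 ▸ this ▸ hv.2.2)
    have hrest := (hparts (A.image c)).union_left (A ∩ X) (Finset.disjoint_left.2 fun v hv hv' =>
      (Finset.mem_filter.1 hv').2.1 (Finset.mem_inter.1 hv).2)
    have hA' : (A ∩ X) ∪ (A.filter fun v => v ∉ X ∧ c v ∈ A.image c) = A := by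
      ext v
      simp only [Finset.mem_filter, Finset.mem_union, Finset.mem_inter, Finset.mem_image]
      by_cases hv : v ∈ A
      · simp only [hv, true_and]
        have : ∃ a ∈ A, c a = c v := ⟨v, hv, rfl⟩
        tauto
      · tauto
    rw [hA'] at hrest
    obtain ⟨o, ho, ho', how⟩ := hrest
    refine ⟨o, ho, ho', fun l₁ l₂ h => (how l₁ l₂ h).trans ?_⟩
    have : (A ∩ X).card ≤ K := (Finset.card_le_card Finset.inter_subset_right).trans hX
    rw [mul_add, mul_one]
    omega

theorem HasSeparators.hasVertexOrder {n K : ℕ} {G : SimpleGraph (Fin n)} (hG : HasSeparators G K) :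
    HasVertexOrder G (K * (Nat.log 2 n + 1)) := by
  classical
  obtain ⟨o, ho, ho', how⟩ := hG.hasOrderOn (Nat.log 2 n + 1) Finset.univ
    (by simpa using Nat.lt_pow_succ_log_self (by omega) n)
  refine ⟨o, ho, fun v => (ho' v).2 (Finset.mem_univ v), fun i => le_trans
    (Finset.card_le_card fun v hv => ?_) (how _ _ (List.take_append_drop i o).symm)⟩
  obtain ⟨hv, u, hu, huv⟩ := (mem_boundary G).1 hv
  simp only [Finset.mem_filter]
  refine ⟨by convert hv, u, ?_, huv⟩
  have hmem := (ho' u).2 (Finset.mem_univ u)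
  rw [← List.take_append_drop i o, List.mem_append] at hmem
  exact hmem.resolve_left fun h => hu (by simpa using h)

/-- A graph has balanced separators if its vertices are represented by subsets `N v` of a forest,
such that removing a vertex `t` of the forest leaves all `N v` with `t ∉ N v` connected, and connected
to `N u` for the neighbours `u` of `v`; the separators are the sets `{v | t ∈ N v}`. -/
theorem hasSeparators_of_forest {W : Type} [Finite W] [Nonempty W] {T : SimpleGraph W}
    (hT : T.IsAcyclic) {K : ℕ} (bag : W → Finset V) (hbag : ∀ t, (bag t).card ≤ K)
    (hne : ∀ v, ∃ t, v ∈ bag t)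
    (hconn : ∀ v t, v ∉ bag t → ∀ x y, v ∈ bag x → v ∈ bag y →
      (T.deleteIncidenceSet t).Reachable x y)
    (hadj : ∀ u v, G.Adj u v → ∀ t, u ∉ bag t → v ∉ bag t →
      ∃ x y, u ∈ bag x ∧ v ∈ bag y ∧ (T.deleteIncidenceSet t).Reachable x y) :
    HasSeparators G K := by
  classical
  intro A
  obtain ⟨t, ht⟩ := exists_centroid hT A (fun v => {x | v ∈ bag x}) hne
  choose r hr using hne
  refine ⟨bag t, hbag t, (T.deleteIncidenceSet t).ConnectedComponent,
    fun v => (T.deleteIncidenceSet t).connectedComponentMk (r v), fun u _ v _ hu hv huv => ?_,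
    fun i => ?_⟩
  · obtain ⟨x, y, hx, hy, hxy⟩ := hadj u v huv t hu hv
    rw [SimpleGraph.ConnectedComponent.eq]
    exact ((hconn u t hu _ _ (hr u) hx).trans hxy).trans (hconn v t hv _ _ hy (hr v))
  · induction i using SimpleGraph.ConnectedComponent.ind with | h x => ?_
    refine le_trans (Nat.mul_le_mul_left 2 (Finset.card_le_card fun v hv => ?_)) (ht x)
    rw [Finset.mem_filter] at hv ⊢
    refine ⟨hv.1, fun y hy => ⟨?_, ?_⟩⟩
    · rintro rfl
      exact hv.2.1 hy
    · exact (SimpleGraph.ConnectedComponent.eq.1 hv.2.2).symm.trans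
        (hconn v t hv.2.1 _ _ (hr v) hy)

end Separator

/-! ### Graphs of bounded treewidth, forests, paths and cycles -/

theorem TreeDecomposition.hasSeparators {V : Type*} {G : SimpleGraph V} (D : TreeDecomposition G) :
    HasSeparators G (D.width + 1) := by
  have := D.isTree.connected.nonempty
  refine hasSeparators_of_forest D.isTree.isAcyclic D.bag (fun t => ?_) D.vertex_mem
    (fun v t hv x y hx hy => ?_) fun u v huv t hu hv => ?_
  · have := Finset.le_sup (f := fun t => (D.bag t).card) (Finset.mem_univ t)
    simp only [width]
    omega
  · have h := (D.connected v).preconnected ⟨x, hx⟩ ⟨y, hy⟩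
    refine h.map (G' := D.tree.deleteIncidenceSet t) ⟨Subtype.val, fun {a b} hab => ?_⟩
    refine SimpleGraph.deleteIncidenceSet_adj.2 ⟨hab, ?_, ?_⟩
    · rintro rfl
      exact hv a.2
    · rintro rfl
      exact hv b.2
  · obtain ⟨x, hx, hy⟩ := D.edge_mem u v huv
    exact ⟨x, x, hx, hy, .refl _⟩

/-- The tree decomposition with one bag. -/
def TreeDecomposition.trivial {V : Type*} [Fintype V] (G : SimpleGraph V) :
    TreeDecomposition G where
  m := 1
  tree := ⊥
  isTree := .of_subsingleton
  bag _ := Finset.univ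
  vertex_mem v := ⟨0, Finset.mem_univ v⟩
  edge_mem u v _ := ⟨0, Finset.mem_univ u, Finset.mem_univ v⟩
  connected v := by
    have : Nonempty {t : Fin 1 | v ∈ (Finset.univ : Finset V)} := ⟨⟨0, Finset.mem_univ v⟩⟩
    exact .of_subsingleton

theorem hasSeparators_of_treewidth_le {V : Type*} [Fintype V] {G : SimpleGraph V} {k : ℕ}
    (h : treewidth G ≤ k) : HasSeparators G (k + 1) := by
  obtain ⟨D, hD⟩ := Nat.sInf_mem (s := {w | ∃ D : TreeDecomposition G, D.width = w})
    ⟨_, .trivial G, rfl⟩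
  intro A
  obtain ⟨X, hX, hA⟩ := D.hasSeparators A
  refine ⟨X, hX.trans ?_, hA⟩
  rw [hD]
  exact Nat.succ_le_succ h

theorem hasSeparators_of_isAcyclic {n : ℕ} {G : SimpleGraph (Fin n)} (hG : G.IsAcyclic) :
    HasSeparators G 1 := by
  -- a forest is represented by itself, with one vertex in each bag; it has to be nonempty
  cases n with
  | zero => exact fun A => ⟨∅, by simp, Unit, fun _ => (), fun _ _ _ _ _ _ _ => rfl, fun _ => by
      simp [Finset.eq_empty_of_isEmpty A]⟩
  | succ n =>
    refine hasSeparators_of_forest hG (fun t => {t}) (fun t => by simp) (fun v => ⟨v, by simp⟩)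
      (fun v t hv x y hx hy => ?_) fun u v huv t hu hv => ⟨u, v, by simp, by simp, ?_⟩
    · rw [Finset.mem_singleton] at hx hy
      rw [← hx, hy]
    · rw [Finset.mem_singleton] at hu hv
      exact SimpleGraph.Adj.reachable (SimpleGraph.deleteIncidenceSet_adj.2 ⟨huv, hu, hv⟩)

/-- If each vertex other than the first one is adjacent to no later vertex but the next one, then only
the first and the last vertex of an initial segment can be on its boundary. -/
theorem hasVertexOrder_two {n : ℕ} {G H : SimpleGraph (Fin n)} (e : G ≃g H)
    (hH : ∀ a b, H.Adj a b → a < b → a.val = 0 ∨ a.val + 1 = b.val) : HasVertexOrder G 2 := by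
  refine ⟨(List.finRange n).map e.symm, (List.nodup_finRange n).map e.symm.injective, fun v =>
    List.mem_map.2 ⟨e v, List.mem_finRange _, e.symm_apply_apply v⟩, fun i => ?_⟩
  have hmem : ∀ v, v ∈ (((List.finRange n).map e.symm).take i).toFinset ↔ (e v).val < i := by
    intro v
    rw [List.mem_toFinset, ← List.map_take, List.mem_map]
    constructor
    · rintro ⟨a, ha, rfl⟩
      obtain ⟨j, hj, hja⟩ := List.mem_take_iff_getElem.1 ha
      rw [e.apply_symm_apply, ← hja]
      simp
      omega
    · intro hv
      refine ⟨e v, List.mem_take_iff_getElem.2 ⟨e v, ?_, ?_⟩, e.symm_apply_apply v⟩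
      · simp [hv]
      · simp
  refine (Finset.card_le_card_of_injOn (t := {0, i - 1}) (fun v => (e v).val) (fun v hv => ?_)
    fun u _ v _ huv => e.injective (Fin.ext huv)).trans Finset.card_le_two
  obtain ⟨hv, u, hu, huv⟩ := (mem_boundary G).1 hv
  rw [hmem] at hv hu
  have := hH (e v) (e u) (e.map_adj_iff.2 huv) (Fin.lt_def.2 (by omega))
  simp only [Finset.coe_insert, Finset.coe_singleton, Set.mem_insert_iff, Set.mem_singleton_iff]
  omega

theorem HasVertexOrder.mono {n w w' : ℕ} {G : SimpleGraph (Fin n)} (h : HasVertexOrder G w)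
    (hw : w ≤ w') : HasVertexOrder G w' := by
  obtain ⟨o, ho, ho', how⟩ := h
  exact ⟨o, ho, ho', fun i => (how i).trans hw⟩

theorem hasVertexOrder_of_path {n : ℕ} {G : SimpleGraph (Fin n)} (h : paths n G) :
    HasVertexOrder G 2 := by
  obtain ⟨e⟩ := h
  refine hasVertexOrder_two e fun a b hab hlt => ?_
  rw [SimpleGraph.pathGraph_adj] at hab
  rw [Fin.lt_def] at hlt
  omega

theorem hasVertexOrder_of_cycle {n : ℕ} {G : SimpleGraph (Fin n)} (h : cycles n G) :
    HasVertexOrder G 2 := by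
  obtain ⟨-, ⟨e⟩⟩ := h
  refine hasVertexOrder_two e fun a b hab hlt => ?_
  rw [SimpleGraph.cycleGraph_adj'] at hab
  rw [Fin.lt_def] at hlt
  rcases hab with hab | hab
  · rw [Fin.coe_sub_iff_lt.2 (Fin.lt_def.2 hlt)] at hab
    omega
  · rw [Fin.sub_val_of_le (Fin.le_def.2 hlt.le)] at hab
    omega

/-- Logarithmic vertex separation numbers suffice. -/
theorem solvableInOStar_of_log {𝒢 : GraphClass} (K : ℕ)
    (h : ∀ n G, 𝒢 n G → HasVertexOrder G (K * (Nat.log 2 n + 1))) :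
    SolvableInOStar 𝒢 fun n => 4 ^ n := by
  obtain ⟨D, hD⟩ := exists_pow_log_le K
  exact solvableInOStar_of_hasVertexOrder D fun n G hG => ⟨_, h n G hG, hD n⟩

end MEGHA

theorem corollary2 :
    (∀ k : ℕ, MEGHA.SolvableInOStar (MEGHA.treewidthAtMost k) (fun n => 4 ^ n)) ∧
      MEGHA.SolvableInOStar MEGHA.cycles (fun n => 4 ^ n) ∧
      MEGHA.SolvableInOStar MEGHA.paths (fun n => 4 ^ n) ∧
      MEGHA.SolvableInOStar MEGHA.forests (fun n => 4 ^ n) := by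
  refine ⟨fun k => MEGHA.solvableInOStar_of_log (k + 1) fun n G hG =>
      (MEGHA.hasSeparators_of_treewidth_le hG).hasVertexOrder,
    MEGHA.solvableInOStar_of_log 2 fun n G hG => (MEGHA.hasVertexOrder_of_cycle hG).mono (by omega),
    MEGHA.solvableInOStar_of_log 2 fun n G hG => (MEGHA.hasVertexOrder_of_path hG).mono (by omega),
    MEGHA.solvableInOStar_of_log 1 fun n G hG =>
      (MEGHA.hasSeparators_of_isAcyclic hG).hasVertexOrder⟩
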